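/- Let $p>3$ be a prime and let $$M_1=\langle\rho,\sigma,\tau\mid\rho^p=\sigma^p=\tau^p=1,\ \sigma\rho=\rho\sigma,\ \tau\rho=\rho\tau,\ \tau\sigma=\rho\sigma\tau\rangle$$ be the Heisenberg group of order $p^3$. A skew brace $(B,\oplus,\odot)$ is a set with two group structures such that $a\odot(b\oplus c)=(a\odot b)\ominus a\oplus(a\odot c)$ for all $a,b,c$. It is of $M_1$ type if $(B,\oplus)\cong M_1$, and trivial if $\oplus=\odot$. Let $\lambda:(B,\odot)\to\mathrm{Aut}(B,\oplus)$, $\lambda_a(b)=\ominus a\oplus(a\odot b)$. Put $$\mathrm{Soc}(B)=\{a\in B\mid a\oplus b=a\odot b,\ b\oplus(b\odot a)=(b\odot a)\oplus b\ \text{for all } b\in B\},\qquad \mathrm{Ann}(B)=\mathrm{Soc}(B)\cap Z(B,\odot).$$ An annihilator extension is a short exact sequence $A\to E\to Q$ of skew braces in which the image of $A$ is contained in $\mathrm{Ann}(E)$. Let $B$ be a skew brace of $M_1$ type. 1. If $B$ is not trivial, then $|\ker\lambda|\in\{p^2,p,1\}$. 2. If $|\ker\lambda|$ is $p^2$ or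 $p$, then $\mathrm{Soc}(B)=\mathrm{Ann}(B)=Z(B,\oplus)$, and every isomorphism $(B,\oplus)\to M_1$ maps this set onto $\langle\rho\rangle=Z(M_1)$. 3. If $|\ker\lambda|=1$, then $\mathrm{Soc}(B)=\mathrm{Ann}(B)$ consists of the identity only. Consequently $B$ is not the middle term of any annihilator extension $A\to B\to Q$ with $A$ non-zero. 4. Up to isomorphism there are exactly four skew braces of $M_1$ type with $|\ker\lambda|=1$. Namely, let $\alpha_1,\alpha_2,\alpha_3\in\mathrm{Aut}(M_1)$ be given by $$\alpha_1:\sigma\mapsto\rho\sigma,\ \tau\mapsto\tau;\qquad \alpha_2:\sigma\mapsto\sigma\tau,\ \tau\mapsto\tau;\qquad \alpha_3:\sigma\mapsto\sigma,\ \tau\mapsto\rho\tau,$$ and let $\delta\in\mathbb F_p$ be any fixed non-square. For $s\in\{1,\delta\}$ and $t\in\{0,1\}$ the subgroup $$H_{s,t}=\langle\tau^{-2}\alpha_1,\ \rho^{s}\tau\alpha_2,\ \sigma^{2}\tau^{t}\alpha_3\rangle$$ of the holomorph $\mathrm{Hol}(M_1)=M_1\rtimes\mathrm{Aut}(M_1)$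 is regular on $M_1$. Make $H_{s,t}$ a skew brace in which $\odot$ is the group operation of $H_{s,t}$ and $\oplus$ is carried over from $M_1$ by the bijection $h\mapsto h(1)$. Then $H_{s,t}$ is of $M_1$ type, $(H_{s,t},\odot)\cong M_1$, and $|\ker\lambda|=1$. Every skew brace of $M_1$ type with $|\ker\lambda|=1$ is isomorphic to $H_{s,t}$ for exactly one pair $(s,t)$. -/

import Mathlib

/-! ### Skew braces -/

/-- A skew (left) brace: two group structures `(B, +)` (not necessarily abelian) and `(B, *)`
with `a * (b + c) = a * b - a + a * c`. -/
class SkewBrace (B : Type*) extends AddGroup B, Group B where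
  brace : ∀ a b c : B, a * (b + c) = a * b + -a + a * c

namespace SkewBrace

variable {B : Type*} [SkewBrace B]

theorem mul_zero_eq (a : B) : a * (0 : B) = a := by
  have h := brace a 0 0
  rw [add_zero, add_assoc] at h
  have h2 : -a + a * (0 : B) = 0 := by
    have h3 : a * (0 : B) + (-a + a * 0) = a * (0 : B) + 0 := by rw [← h, add_zero]
    exact add_left_cancel h3
  rw [neg_add_eq_zero] at h2
  exact h2.symm

theorem one_eq_zero : (1 : B) = 0 := by
  have h := mul_zero_eq (1 : B)
  rw [one_mul] at h
  exact h.symm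

theorem lam_mul (a b c : B) : -(a * b) + a * b * c = -a + a * (-b + b * c) := by
  have h := brace a b (-b + b * c)
  rw [add_neg_cancel_left, ← mul_assoc] at h
  rw [h]
  simp only [add_assoc, neg_add_cancel_left]

/-- The homomorphism `λ : (B, *) → Aut (B, +)`, `λ_a (b) = -a + a * b`; the additive group of `B`
is written as `Multiplicative B`. -/
def lam (B : Type*) [SkewBrace B] : B →* MulAut (Multiplicative B) where
  toFun a :=
    { toFun := fun b => Multiplicative.ofAdd (-a + a * b.toAdd)
      invFun := fun b => Multiplicative.ofAdd (-a⁻¹ + a⁻¹ * b.toAdd)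
      left_inv := fun b => by
        change -a⁻¹ + a⁻¹ * (-a + a * b.toAdd) = b.toAdd
        rw [← lam_mul, inv_mul_cancel, one_mul, one_eq_zero, neg_zero, zero_add]
      right_inv := fun b => by
        change -a + a * (-a⁻¹ + a⁻¹ * b.toAdd) = b.toAdd
        rw [← lam_mul, mul_inv_cancel, one_mul, one_eq_zero, neg_zero, zero_add]
      map_mul' := fun b c => by
        change -a + a * (b.toAdd + c.toAdd) = (-a + a * b.toAdd) + (-a + a * c.toAdd)
        rw [brace]
        simp only [add_assoc] }
  map_one' := by
    ext b
    change -(1 : B) + 1 * b.toAdd = b.toAdd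
    rw [one_mul, one_eq_zero, neg_zero, zero_add]
  map_mul' a b := by
    ext c
    exact lam_mul a b c.toAdd

variable (B)

/-- The trivial skew braces: the two operations coincide. -/
def IsTrivial : Prop := ∀ a b : B, a * b = a + b

/-- The socle of a skew brace. -/
def socle : Set B :=
  {a | ∀ b : B, a + b = a * b ∧ b + b * a = b * a + b}

/-- The annihilator of a skew brace, `Soc B ∩ Z (B, *)`. -/
def annihilator : Set B := socle B ∩ (Subgroup.center B : Set B)

/-- `B` is of type `N` if its additive group is isomorphic to `N`. -/
def IsOfType (N : Type*) [Group N] : Prop := Nonempty (Multiplicative B ≃* N)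

variable {B}

/-- A morphism of skew braces: a homomorphism for both operations. -/
structure IsHom {C : Type*} [SkewBrace C] (f : B → C) : Prop where
  map_add : ∀ a b, f (a + b) = f a + f b
  map_mul : ∀ a b, f (a * b) = f a * f b

/-- `A → E → Q` is an annihilator extension: a short exact sequence of skew braces in which the
image of `A` lies in the annihilator of `E`. -/
structure IsAnnihilatorExtension {A E Q : Type*} [SkewBrace A] [SkewBrace E] [SkewBrace Q]
    (i : A → E) (q : E → Q) : Prop where
  hom_left : IsHom i
  hom_right : IsHom q
  injective : Function.Injective i
  surjective : Function.Surjective q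
  exact : Set.range i = {e | q e = 0}
  range_subset : Set.range i ⊆ annihilator E

end SkewBrace

/-! ### The holomorph and the skew brace of a regular subgroup -/

/-- The holomorph `N ⋊ Aut N`; the element `η α` is the pair `⟨η, α⟩`. -/
abbrev Hol (N : Type*) [Group N] : Type _ := N ⋊[MonoidHom.id (MulAut N)] MulAut N

namespace Hol

variable {N : Type*} [Group N]

/-- The action of the holomorph on `N`: the element `η α` sends `n` to `η * α n`. -/
def act (h : Hol N) (n : N) : N := h.left * h.right n

/-- A subgroup of the holomorph is regular if it acts simply transitively on `N`. -/
def IsRegular (H : Subgroup (Hol N)) : Prop :=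
  ∀ x y : N, ∃! h : H, act (h : Hol N) x = y

theorem bijective_of_isRegular {H : Subgroup (Hol N)} (hH : IsRegular H) :
    Function.Bijective (fun h : H => act (h : Hol N) 1) :=
  (Function.bijective_iff_existsUnique _).2 fun y => hH 1 y

/-- The skew brace of a regular subgroup `H` of the holomorph of `N`: it has `H` as its underlying
set and as its multiplicative group. -/
def Brace (H : Subgroup (Hol N)) (_hH : IsRegular H) : Type _ := H

variable {H : Subgroup (Hol N)} {hH : IsRegular H}

namespace Brace

instance : Group (Brace H hH) := inferInstanceAs (Group H)

/-- The bijection `h ↦ h (1)` from `H` to `N`. -/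
noncomputable def psi : Brace H hH ≃ N :=
  Equiv.ofBijective (fun h : H => act (h : Hol N) 1) (bijective_of_isRegular hH)

theorem psi_mul (g h : Brace H hH) : psi (g * h) = act (Subtype.val g) (psi h) := by
  change (Subtype.val g * Subtype.val h).left * (Subtype.val g * Subtype.val h).right 1 =
    (Subtype.val g).left * (Subtype.val g).right ((Subtype.val h).left * (Subtype.val h).right 1)
  simp

/-- The additive operation `g + h = ψ⁻¹ (ψ g * ψ h)`. -/
noncomputable instance : Add (Brace H hH) := ⟨fun g h => psi.symm (psi g * psi h)⟩
noncomputable instance : Zero (Brace H hH) := ⟨psi.symm 1⟩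
noncomputable instance : Neg (Brace H hH) := ⟨fun g => psi.symm (psi g)⁻¹⟩

theorem psi_add (g h : Brace H hH) : psi (g + h) = psi g * psi h :=
  Equiv.apply_symm_apply _ _
theorem psi_zero : psi (0 : Brace H hH) = 1 := Equiv.apply_symm_apply _ _
theorem psi_neg (g : Brace H hH) : psi (-g) = (psi g)⁻¹ := Equiv.apply_symm_apply _ _

noncomputable instance : AddGroup (Brace H hH) :=
  AddGroup.ofLeftAxioms
    (fun a b c => psi.injective (by simp only [psi_add, mul_assoc]))
    (fun a => psi.injective (by simp only [psi_add, psi_zero, one_mul]))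
    (fun a => psi.injective (by simp only [psi_add, psi_neg, psi_zero, inv_mul_cancel]))

noncomputable instance : SkewBrace (Brace H hH) where
  brace a b c := psi.injective (by
    have ha : psi a = (Subtype.val a).left := by
      change (Subtype.val a).left * (Subtype.val a).right 1 = _
      simp
    simp only [psi_add, psi_neg, psi_mul, ha]
    simp [act, mul_assoc])

end Brace

end Hol

/-! ### The Heisenberg group `M₁` and its automorphisms `α₁, α₂, α₃` -/

/-- The underlying set of the Heisenberg group `M₁` of order `p ^ 3`: the triple `⟨a, b, c⟩`
stands for the normal form `ρ ^ a * σ ^ b * τ ^ c`. -/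
@[ext] structure M1 (p : ℕ) where
  r : ZMod p
  s : ZMod p
  t : ZMod p

namespace M1

variable {p : ℕ}

instance : Mul (M1 p) := ⟨fun x y => ⟨x.r + y.r + x.t * y.s, x.s + y.s, x.t + y.t⟩⟩
instance : One (M1 p) := ⟨⟨0, 0, 0⟩⟩
instance : Inv (M1 p) := ⟨fun x => ⟨-x.r + x.t * x.s, -x.s, -x.t⟩⟩

@[simp] theorem mul_r (x y : M1 p) : (x * y).r = x.r + y.r + x.t * y.s := rfl
@[simp] theorem mul_s (x y : M1 p) : (x * y).s = x.s + y.s := rfl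
@[simp] theorem mul_t (x y : M1 p) : (x * y).t = x.t + y.t := rfl
@[simp] theorem one_r : (1 : M1 p).r = 0 := rfl
@[simp] theorem one_s : (1 : M1 p).s = 0 := rfl
@[simp] theorem one_t : (1 : M1 p).t = 0 := rfl
@[simp] theorem inv_r (x : M1 p) : (x⁻¹).r = -x.r + x.t * x.s := rfl
@[simp] theorem inv_s (x : M1 p) : (x⁻¹).s = -x.s := rfl
@[simp] theorem inv_t (x : M1 p) : (x⁻¹).t = -x.t := rfl

instance : Group (M1 p) :=
  Group.ofLeftAxioms (fun x y z => by ext <;> simp <;> ring) (fun x => by ext <;> simp)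
    (fun x => by ext <;> simp)

/-- The generators `ρ`, `σ`, `τ`. -/
def rho : M1 p := ⟨1, 0, 0⟩
def sigma : M1 p := ⟨0, 1, 0⟩
def tau : M1 p := ⟨0, 0, 1⟩

theorem rho_pow (n : ℕ) : (rho : M1 p) ^ n = ⟨n, 0, 0⟩ := by
  induction n with
  | zero => ext <;> simp
  | succ n ih => rw [pow_succ, ih]; ext <;> simp [rho]

theorem sigma_pow (n : ℕ) : (sigma : M1 p) ^ n = ⟨0, n, 0⟩ := by
  induction n with
  | zero => ext <;> simp
  | succ n ih => rw [pow_succ, ih]; ext <;> simp [sigma]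

theorem tau_pow (n : ℕ) : (tau : M1 p) ^ n = ⟨0, 0, n⟩ := by
  induction n with
  | zero => ext <;> simp
  | succ n ih => rw [pow_succ, ih]; ext <;> simp [tau]

/-- The defining relators of `M₁` on generators `ρ, σ, τ` (numbered `0, 1, 2`):
`ρ ^ p`, `σ ^ p`, `τ ^ p`, `σ ρ = ρ σ`, `τ ρ = ρ τ`, `τ σ = ρ σ τ`. -/
def relators (p : ℕ) : Set (FreeGroup (Fin 3)) :=
  let ρ := FreeGroup.of (0 : Fin 3)
  let σ := FreeGroup.of (1 : Fin 3)
  let τ := FreeGroup.of (2 : Fin 3)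
  {ρ ^ p, σ ^ p, τ ^ p, σ * ρ * (ρ * σ)⁻¹, τ * ρ * (ρ * τ)⁻¹, τ * σ * (ρ * σ * τ)⁻¹}

/-- The map from the presented group that sends the generators to `ρ, σ, τ`. -/
def ofPresented (p : ℕ) : PresentedGroup (relators p) →* M1 p :=
  PresentedGroup.toGroup (f := ![rho, sigma, tau]) (by
    intro w hw
    simp only [relators, Set.mem_insert_iff, Set.mem_singleton_iff] at hw
    rcases hw with rfl | rfl | rfl | rfl | rfl | rfl
    · simp only [map_pow, FreeGroup.lift_apply_of]
      change rho ^ p = 1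
      rw [rho_pow]; ext <;> simp
    · simp only [map_pow, FreeGroup.lift_apply_of]
      change sigma ^ p = 1
      rw [sigma_pow]; ext <;> simp
    · simp only [map_pow, FreeGroup.lift_apply_of]
      change tau ^ p = 1
      rw [tau_pow]; ext <;> simp
    all_goals
      simp only [map_mul, map_inv, FreeGroup.lift_apply_of]
      rw [mul_inv_eq_one]
      ext <;> simp [rho, sigma, tau])

/-- `M1 p` is the group presented by the generators `ρ, σ, τ` and the relators above. -/
theorem ofPresented_bijective (p : ℕ) [NeZero p] : Function.Bijective (ofPresented p) := by
  set R : PresentedGroup (relators p) := PresentedGroup.of 0 with hR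
  set S : PresentedGroup (relators p) := PresentedGroup.of 1 with hS
  set T : PresentedGroup (relators p) := PresentedGroup.of 2 with hT
  have one : ∀ w ∈ relators p, PresentedGroup.mk (relators p) w = 1 := fun w hw =>
    PresentedGroup.one_of_mem hw
  have r1 : R ^ p = 1 := by
    have := one (FreeGroup.of 0 ^ p) (by simp [relators]); exact this
  have r2 : S ^ p = 1 := by
    have := one (FreeGroup.of 1 ^ p) (by simp [relators]); exact this
  have r3 : T ^ p = 1 := by
    have := one (FreeGroup.of 2 ^ p) (by simp [relators]); exact this
  have r4 : S * R = R * S := by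
    have := one (FreeGroup.of 1 * FreeGroup.of 0 * (FreeGroup.of 0 * FreeGroup.of 1)⁻¹)
      (by simp [relators])
    rw [map_mul, map_inv, mul_inv_eq_one] at this; exact this
  have r5 : T * R = R * T := by
    have := one (FreeGroup.of 2 * FreeGroup.of 0 * (FreeGroup.of 0 * FreeGroup.of 2)⁻¹)
      (by simp [relators])
    rw [map_mul, map_inv, mul_inv_eq_one] at this; exact this
  have r6 : T * S = R * S * T := by
    have := one (FreeGroup.of 2 * FreeGroup.of 1 *
      (FreeGroup.of 0 * FreeGroup.of 1 * FreeGroup.of 2)⁻¹) (by simp [relators])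
    rw [map_mul, map_inv, mul_inv_eq_one] at this; exact this
  have pS : ∀ n : ℕ, T * S ^ n = R ^ n * S ^ n * T := by
    intro n
    induction n with
    | zero => simp
    | succ n ih =>
      have c : S ^ n * R = R * S ^ n := (Commute.pow_left (show Commute S R from r4) n)
      calc T * S ^ (n + 1) = (T * S ^ n) * S := by rw [pow_succ, mul_assoc]
        _ = R ^ n * S ^ n * (T * S) := by rw [ih, mul_assoc]
        _ = R ^ n * (S ^ n * R) * S * T := by rw [r6]; simp only [mul_assoc]
        _ = _ := by rw [c, pow_succ, pow_succ]; simp only [mul_assoc]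
  have norm : ∀ g : PresentedGroup (relators p), ∃ a b c : ℕ, g = R ^ a * S ^ b * T ^ c := by
    have key : ∀ x : Fin 3, ∀ a b c : ℕ, ∃ a' b' c' : ℕ,
        (PresentedGroup.of x : PresentedGroup (relators p)) * (R ^ a * S ^ b * T ^ c)
          = R ^ a' * S ^ b' * T ^ c' := by
      intro x a b c
      fin_cases x
      · exact ⟨a + 1, b, c, by
          change R * _ = _
          rw [pow_succ']; simp only [mul_assoc]⟩
      · refine ⟨a, b + 1, c, ?_⟩
        change S * _ = _
        have c' : S * R ^ a = R ^ a * S := (Commute.pow_right (show Commute S R from r4) a)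
        rw [← mul_assoc, ← mul_assoc, c', pow_succ']; simp only [mul_assoc]
      · refine ⟨a + b, b, c + 1, ?_⟩
        change T * _ = _
        have c' : T * R ^ a = R ^ a * T := (Commute.pow_right (show Commute T R from r5) a)
        rw [← mul_assoc, ← mul_assoc, c', mul_assoc (R ^ a), pS, pow_succ', pow_add]
        simp only [mul_assoc]
    have keyn : ∀ x : Fin 3, ∀ n a b c : ℕ, ∃ a' b' c' : ℕ,
        (PresentedGroup.of x : PresentedGroup (relators p)) ^ n * (R ^ a * S ^ b * T ^ c)
          = R ^ a' * S ^ b' * T ^ c' := by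
      intro x n
      induction n with
      | zero => intro a b c; exact ⟨a, b, c, by simp⟩
      | succ n ih =>
        intro a b c
        obtain ⟨a', b', c', h⟩ := key x a b c
        rw [pow_succ, mul_assoc, h]
        exact ih _ _ _
    have invp : ∀ x : Fin 3, (PresentedGroup.of x : PresentedGroup (relators p))⁻¹ =
        (PresentedGroup.of x) ^ (p - 1) := by
      intro x
      rw [inv_eq_iff_mul_eq_one, ← pow_succ', Nat.sub_add_cancel (NeZero.one_le)]
      fin_cases x
      · exact r1
      · exact r2
      · exact r3
    intro g
    have hg : g ∈ Subgroup.closure (Set.range (PresentedGroup.of (rels := relators p))) := by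
      rw [PresentedGroup.closure_range_of]; trivial
    induction hg using Subgroup.closure_induction_left with
    | one => exact ⟨0, 0, 0, by simp⟩
    | mul_left x hx y _ ih =>
      obtain ⟨i, rfl⟩ := hx
      obtain ⟨a, b, c, rfl⟩ := ih
      exact key i a b c
    | inv_mul_cancel x hx y _ ih =>
      obtain ⟨i, rfl⟩ := hx
      obtain ⟨a, b, c, rfl⟩ := ih
      rw [invp]
      exact keyn i _ a b c
  have ev : ∀ a b c : ℕ, ofPresented p (R ^ a * S ^ b * T ^ c) = ⟨a, b, c⟩ := by
    intro a b c
    have e0 : ofPresented p R = rho := by simp [ofPresented, hR]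
    have e1 : ofPresented p S = sigma := by simp [ofPresented, hS]
    have e2 : ofPresented p T = tau := by simp [ofPresented, hT]
    rw [map_mul, map_mul, map_pow, map_pow, map_pow, e0, e1, e2, rho_pow, sigma_pow, tau_pow]
    ext <;> simp
  constructor
  · rw [injective_iff_map_eq_one]
    intro g hg
    obtain ⟨a, b, c, rfl⟩ := norm g
    rw [ev, M1.ext_iff] at hg
    obtain ⟨ha, hb, hc⟩ := hg
    simp only [one_r, one_s, one_t, ZMod.natCast_eq_zero_iff] at ha hb hc
    obtain ⟨a, rfl⟩ := ha
    obtain ⟨b, rfl⟩ := hb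
    obtain ⟨c, rfl⟩ := hc
    simp [pow_mul, r1, r2, r3]
  · intro x
    refine ⟨R ^ x.r.val * S ^ x.s.val * T ^ x.t.val, ?_⟩
    rw [ev]
    ext <;> simp

/-- `α₁ : σ ↦ ρ σ, τ ↦ τ`. -/
def alpha1 : MulAut (M1 p) where
  toFun x := ⟨x.r + x.s, x.s, x.t⟩
  invFun x := ⟨x.r - x.s, x.s, x.t⟩
  left_inv x := by ext <;> simp
  right_inv x := by ext <;> simp
  map_mul' x y := by ext <;> simp; ring

/-- `α₃ : σ ↦ σ, τ ↦ ρ τ`. -/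
def alpha3 : MulAut (M1 p) where
  toFun x := ⟨x.r + x.t, x.s, x.t⟩
  invFun x := ⟨x.r - x.t, x.s, x.t⟩
  left_inv x := by ext <;> simp
  right_inv x := by ext <;> simp
  map_mul' x y := by ext <;> simp; ring

/-- `α₂ : σ ↦ σ τ, τ ↦ τ`, for odd `p`; on normal forms,
`ρ ^ a * σ ^ b * τ ^ c ↦ ρ ^ (a + b (b - 1) / 2) * σ ^ b * τ ^ (c + b)`. -/
def alpha2 [Fact p.Prime] (hp : 3 < p) : MulAut (M1 p) where
  toFun x := ⟨x.r + x.s * (x.s - 1) / 2, x.s, x.t + x.s⟩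
  invFun x := ⟨x.r - x.s * (x.s - 1) / 2, x.s, x.t - x.s⟩
  left_inv x := by ext <;> simp
  right_inv x := by ext <;> simp
  map_mul' x y := by
    have h2 : (2 : ZMod p) ≠ 0 := by
      intro h
      have h' : ((2 : ℕ) : ZMod p) = 0 := by exact_mod_cast h
      rw [ZMod.natCast_eq_zero_iff] at h'
      have := Nat.le_of_dvd (by norm_num) h'
      omega
    ext
    · simp
      field_simp
      ring
    · simp
    · simp; ring

/-- The subgroup `⟨τ⁻² α₁, ρ ^ s τ α₂, σ² τ ^ t α₃⟩` of the holomorph of `M₁`. -/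
def kerOneSubgroup [Fact p.Prime] (hp : 3 < p) (s t : ZMod p) : Subgroup (Hol (M1 p)) :=
  Subgroup.closure
    {⟨(tau ^ 2)⁻¹, alpha1⟩, ⟨rho ^ s.val * tau, alpha2 hp⟩, ⟨sigma ^ 2 * tau ^ t.val, alpha3⟩}

end M1

/-! The socle is `ker λ ∩ Z (B, +)`. The order of `(B, *)` is `p ^ 3`, so this p-group fixes the
centre `Z (B, +)`, of order `p`, pointwise. Hence central elements of `ker λ` are also central for
`*`, and parts 2 and 3 reduce to locating `ker λ ∩ Z (B, +)`.

If `ker λ` is non-trivial, the image of `λ` has order at most `p ^ 2` and is abelian, so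
multiplicative commutators lie in `ker λ`. If the centre met `ker λ` trivially, computing the
commutator of a central `z` with `c` would put `λ_z c - c` in `ker λ`. Additive commutators are
central, so these differences would be central as well, hence zero, and `z` would lie in `ker λ`
after all. Since the centre has prime order, it lies in `ker λ` in every case
(`mem_ker_lam_of_commute`, `center_le_ker_lam`).

If `ker λ` is trivial, `λ` embeds `(B, *)` in `Aut M₁`. A p-group fixes a nonzero vector of `M₁ /
Z`; moving it to the class of `τ` puts the image inside the group of all `unip u`, itself a copy of
`M₁`. Equal orders make this an isomorphism, so `B` amounts to a bijective crossed homomorphism `π`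
with `π (u v) = π u * unip u (π v)` (`nonempty_unipotentFrame`). The relations of `M₁` and
bijectivity restrict `π` on the generators (`pi_generators`); conjugation by `unip v` brings it to
`cocycle s t` with `s ≠ 0`. Diagonal automorphisms replace `(s, t)` by `(a² s, d t / a)`, which
leaves the square class of `s` and whether `t = 0` (`exists_rescale`). Any isomorphism changes the
parameters in this way (`parameters_of_intertwine`), so these two data are complete invariants. -/

/-! ### The Heisenberg group, its unipotent automorphisms and the subgroups `H_{s,t}`. -/

namespace M1

variable {p : ℕ}

/-- The coordinates `r, s, t` identify the set `M1 p` with `(ℤ/p)³`. -/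
def equivProd (p : ℕ) : M1 p ≃ ZMod p × ZMod p × ZMod p where
  toFun x := (x.r, x.s, x.t)
  invFun x := ⟨x.1, x.2.1, x.2.2⟩
  left_inv _ := rfl
  right_inv _ := rfl

theorem natCard (p : ℕ) : Nat.card (M1 p) = p ^ 3 := by
  rw [Nat.card_congr (equivProd p), Nat.card_prod, Nat.card_prod, Nat.card_zmod]
  ring

theorem two_ne_zero' [Fact p.Prime] (hp : 3 < p) : (2 : ZMod p) ≠ 0 := by
  intro h
  have h' : ((2 : ℕ) : ZMod p) = 0 := by exact_mod_cast h
  rw [ZMod.natCast_eq_zero_iff] at h'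
  have := Nat.le_of_dvd (by norm_num) h'
  omega

@[simp] theorem pow_s (x : M1 p) (n : ℕ) : (x ^ n).s = n * x.s := by
  induction n with
  | zero => simp
  | succ n ih => rw [pow_succ, mul_s, ih]; push_cast; ring

@[simp] theorem pow_t (x : M1 p) (n : ℕ) : (x ^ n).t = n * x.t := by
  induction n with
  | zero => simp
  | succ n ih => rw [pow_succ, mul_t, ih]; push_cast; ring

theorem eq_pow_mul_pow_mul_pow [NeZero p] (x : M1 p) :
    x = rho ^ x.r.val * sigma ^ x.s.val * tau ^ x.t.val := by
  rw [rho_pow, sigma_pow, tau_pow]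
  ext <;> simp

theorem closure_eq_top [NeZero p] :
    Subgroup.closure {(rho : M1 p), sigma, tau} = ⊤ := by
  rw [Subgroup.eq_top_iff']
  intro x
  rw [eq_pow_mul_pow_mul_pow x]
  refine mul_mem (mul_mem ?_ ?_) ?_ <;> refine pow_mem (Subgroup.subset_closure ?_) _ <;> simp

theorem monoidHom_ext [NeZero p] {G : Type*} [Group G] {f g : M1 p →* G}
    (hr : f rho = g rho) (hs : f sigma = g sigma) (ht : f tau = g tau) : f = g := by
  refine MonoidHom.eq_of_eqOn_dense closure_eq_top ?_
  rintro x (rfl | rfl | rfl) <;> assumption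

theorem mem_center_iff {x : M1 p} : x ∈ Subgroup.center (M1 p) ↔ x.s = 0 ∧ x.t = 0 := by
  rw [Subgroup.mem_center_iff]
  constructor
  · intro h
    have h1 := congrArg M1.r (h sigma)
    have h2 := congrArg M1.r (h tau)
    simp [sigma, tau] at h1 h2
    constructor
    · linear_combination h2
    · linear_combination h1
  · rintro ⟨hs, ht⟩ y
    ext <;> simp [hs, ht, add_comm]

theorem mem_zpowers_rho_iff [NeZero p] {x : M1 p} :
    x ∈ Subgroup.zpowers (rho : M1 p) ↔ x.s = 0 ∧ x.t = 0 := by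
  constructor
  · intro h
    have : Subgroup.zpowers (rho : M1 p) ≤ Subgroup.center (M1 p) := by
      rw [Subgroup.zpowers_le, mem_center_iff]; exact ⟨rfl, rfl⟩
    exact mem_center_iff.1 (this h)
  · rintro ⟨hs, ht⟩
    refine ⟨x.r.val, ?_⟩
    simp only [zpow_natCast, rho_pow]
    ext <;> simp [hs, ht]

theorem zpowers_rho_eq_center [NeZero p] :
    Subgroup.zpowers (rho : M1 p) = Subgroup.center (M1 p) := by
  ext x; rw [mem_zpowers_rho_iff, mem_center_iff]

theorem commutator_mem_center (x y : M1 p) : x * y * x⁻¹ * y⁻¹ ∈ Subgroup.center (M1 p) := by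
  rw [mem_center_iff]; constructor <;> simp

variable [Fact p.Prime]

/-- The automorphism `α₁ ^ f α₂ ^ g α₃ ^ h` attached to `ρ ^ f σ ^ g τ ^ h`. -/
def unip (hp : 3 < p) : M1 p →* MulAut (M1 p) where
  toFun u :=
    { toFun := fun x =>
        -- The binomial term comes from `(σ τ^g)^b = ρ^(g b (b - 1) / 2) σ^b τ^(g b)`.
        ⟨x.r + u.r * x.s + u.t * x.t + u.s * (x.s * (x.s - 1) / 2), x.s, x.t + u.s * x.s⟩
      invFun := fun x =>
        ⟨x.r + (u⁻¹).r * x.s + (u⁻¹).t * x.t + (u⁻¹).s * (x.s * (x.s - 1) / 2), x.s,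
          x.t + (u⁻¹).s * x.s⟩
      left_inv := fun x => by ext <;> simp; ring
      right_inv := fun x => by ext <;> simp; ring
      map_mul' := fun x y => by
        have h2 := two_ne_zero' hp
        ext
        · simp; field_simp; ring
        · simp
        · simp; ring }
  map_one' := by ext <;> simp
  map_mul' u v := by ext <;> simp <;> ring

theorem unip_apply (hp : 3 < p) (u x : M1 p) : unip hp u x =
    ⟨x.r + u.r * x.s + u.t * x.t + u.s * (x.s * (x.s - 1) / 2), x.s, x.t + u.s * x.s⟩ := rfl

theorem unip_rho (hp : 3 < p) : unip hp rho = alpha1 := by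
  ext x <;> simp [unip_apply, rho, alpha1]

theorem unip_sigma (hp : 3 < p) : unip hp sigma = alpha2 hp := by
  ext x <;> simp [unip_apply, sigma, alpha2]

theorem unip_tau (hp : 3 < p) : unip hp tau = alpha3 := by
  ext x <;> simp [unip_apply, tau, alpha3]

theorem unip_injective (hp : 3 < p) : Function.Injective (unip hp) := by
  intro u v h
  have h1 := DFunLike.congr_fun h sigma
  have h2 := DFunLike.congr_fun h tau
  simp [unip_apply, sigma, tau] at h1 h2
  ext
  · exact h1.1
  · exact h1.2
  · exact h2

/-- The crossed homomorphism underlying the subgroup `kerOneSubgroup hp s t`. -/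
def cocycle (s t : ZMod p) (u : M1 p) : M1 p :=
  -- The crossed-homomorphism rule expanded on `ρ^a σ^b τ^c`, starting from the values `τ⁻²`, `ρ^s
  -- τ`, `σ² τ^t` at the generators.
  ⟨-2 * u.r * u.t + 2 * u.s * u.t ^ 2 + 3 / 2 * t * (u.t ^ 2 - u.t) + u.s * u.t + s * u.s,
    2 * u.t, -2 * u.r + 2 * u.s * u.t + u.s + t * u.t⟩

theorem cocycle_mul (hp : 3 < p) (s t : ZMod p) (u v : M1 p) :
    cocycle s t (u * v) = cocycle s t u * unip hp u (cocycle s t v) := by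
  have h2 := two_ne_zero' hp
  ext
  · simp [cocycle, unip_apply]; field_simp; ring
  · simp [cocycle, unip_apply]; ring
  · simp [cocycle, unip_apply]; ring

theorem cocycle_injective (hp : 3 < p) {s : ZMod p} (hs : s ≠ 0) (t : ZMod p) :
    Function.Injective (cocycle s t) := by
  have h2 := two_ne_zero' hp
  intro u v h
  have hS := congrArg M1.s h
  have hT := congrArg M1.t h
  have hR := congrArg M1.r h
  simp only [cocycle] at hS hT hR
  have e3 : u.t = v.t := mul_left_cancel₀ h2 hS
  rw [e3] at hT hR
  -- Subtracting `v.t` times the third coordinate from the first leaves `s * u.s` plus a function of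
  -- `v.t` alone.
  have e2 : u.s = v.s := mul_left_cancel₀ hs (by linear_combination hR - v.t * hT)
  rw [e2] at hT
  have e1 : u.r = v.r := mul_left_cancel₀ h2 (by linear_combination -hT)
  exact M1.ext e1 e2 e3

theorem cocycle_bijective (hp : 3 < p) {s : ZMod p} (hs : s ≠ 0) (t : ZMod p) :
    Function.Bijective (cocycle s t) := by
  have : Finite (M1 p) := Finite.of_equiv _ (equivProd p).symm
  exact Finite.injective_iff_bijective.1 (cocycle_injective hp hs t)

/-- The embedding of `M1 p` into its holomorph with image `kerOneSubgroup hp s t`. -/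
def kerOneHom (hp : 3 < p) (s t : ZMod p) : M1 p →* Hol (M1 p) where
  toFun u := ⟨cocycle s t u, unip hp u⟩
  map_one' := by
    apply SemidirectProduct.ext
    · ext <;> simp [cocycle]
    · simp
  map_mul' u v := by
    apply SemidirectProduct.ext
    · simp [cocycle_mul hp]
    · simp

theorem kerOneHom_rho (hp : 3 < p) (s t : ZMod p) :
    kerOneHom hp s t rho = ⟨(tau ^ 2)⁻¹, alpha1⟩ := by
  apply SemidirectProduct.ext
  · rw [tau_pow]
    ext <;> simp [kerOneHom, cocycle, rho]
  · exact unip_rho hp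

theorem kerOneHom_sigma (hp : 3 < p) (s t : ZMod p) :
    kerOneHom hp s t sigma = ⟨rho ^ s.val * tau, alpha2 hp⟩ := by
  apply SemidirectProduct.ext
  · rw [rho_pow]
    ext <;> simp [kerOneHom, cocycle, sigma, tau]
  · exact unip_sigma hp

theorem kerOneHom_tau (hp : 3 < p) (s t : ZMod p) :
    kerOneHom hp s t tau = ⟨sigma ^ 2 * tau ^ t.val, alpha3⟩ := by
  apply SemidirectProduct.ext
  · rw [sigma_pow, tau_pow]
    ext <;> simp [kerOneHom, cocycle, tau]
  · exact unip_tau hp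

theorem range_kerOneHom (hp : 3 < p) (s t : ZMod p) :
    (kerOneHom hp s t).range = kerOneSubgroup hp s t := by
  rw [MonoidHom.range_eq_map, ← closure_eq_top, MonoidHom.map_closure, kerOneSubgroup,
    Set.image_insert_eq, Set.image_insert_eq, Set.image_singleton, kerOneHom_rho,
    kerOneHom_sigma, kerOneHom_tau]

theorem act_kerOneHom (hp : 3 < p) (s t : ZMod p) (u v : M1 p) :
    Hol.act (kerOneHom hp s t u) (cocycle s t v) = cocycle s t (u * v) :=
  (cocycle_mul hp s t u v).symm

theorem act_kerOneHom_one (hp : 3 < p) (s t : ZMod p) (u : M1 p) :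
    Hol.act (kerOneHom hp s t u) 1 = cocycle s t u := by
  simp [Hol.act, kerOneHom]

theorem kerOneHom_injective (hp : 3 < p) (s t : ZMod p) :
    Function.Injective (kerOneHom hp s t) := fun _ _ h =>
  unip_injective hp (congrArg SemidirectProduct.right h)

/-- The bijection `cocycle s t` turns left translation of `M₁` on itself into the action of the
subgroup, by `act_kerOneHom`. -/
theorem isRegular_kerOneSubgroup (hp : 3 < p) {s : ZMod p} (hs : s ≠ 0) (t : ZMod p) :
    Hol.IsRegular (kerOneSubgroup hp s t) := by
  rw [← range_kerOneHom]
  intro x y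
  have hb := cocycle_bijective hp hs t
  obtain ⟨v, rfl⟩ := hb.2 x
  obtain ⟨w, rfl⟩ := hb.2 y
  refine ⟨⟨kerOneHom hp s t (w * v⁻¹), _, rfl⟩, ?_, ?_⟩
  · change Hol.act (kerOneHom hp s t (w * v⁻¹)) (cocycle s t v) = cocycle s t w
    rw [act_kerOneHom, inv_mul_cancel_right]
  · rintro ⟨_, u, rfl⟩ h
    have : u * v = w := hb.1 (by rw [← act_kerOneHom hp]; exact h)
    simp [← this]

/-- The multiplicative group of the skew brace of `kerOneSubgroup hp s t` is `M1 p`. -/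
noncomputable def kerOneEquiv (hp : 3 < p) (s t : ZMod p)
    (h : Hol.IsRegular (kerOneSubgroup hp s t)) : M1 p ≃* Hol.Brace _ h :=
  ((kerOneHom hp s t).ofInjective (kerOneHom_injective hp s t)).trans
    (MulEquiv.subgroupCongr (range_kerOneHom hp s t))

theorem val_kerOneEquiv (hp : 3 < p) (s t : ZMod p)
    (h : Hol.IsRegular (kerOneSubgroup hp s t)) (u : M1 p) :
    Subtype.val (kerOneEquiv hp s t h u) = kerOneHom hp s t u := rfl

theorem psi_kerOneEquiv (hp : 3 < p) (s t : ZMod p)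
    (h : Hol.IsRegular (kerOneSubgroup hp s t)) (u : M1 p) :
    Hol.Brace.psi (kerOneEquiv hp s t h u) = cocycle s t u :=
  act_kerOneHom_one hp s t u

end M1

/-! ### The additive group and `λ` for the skew brace of a regular subgroup. -/

namespace Hol.Brace

variable {N : Type*} [Group N] {H : Subgroup (Hol N)} {hH : IsRegular H}

/-- The additive group of the skew brace of a regular subgroup is `N`. -/
noncomputable def psiMulEquiv : Multiplicative (Brace H hH) ≃* N where
  toEquiv := Multiplicative.toAdd.trans psi
  map_mul' a b := psi_add a.toAdd b.toAdd

theorem psi_lam (g h : Brace H hH) : psi (-g + g * h) = (Subtype.val g).right (psi h) := by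
  have hg : psi g = (Subtype.val g).left := by
    change (Subtype.val g).left * (Subtype.val g).right 1 = _
    simp
  rw [psi_add, psi_neg, psi_mul, hg, act, inv_mul_cancel_left]

theorem right_eq_one_of_mem_ker_lam {g : Brace H hH}
    (hg : g ∈ (SkewBrace.lam (Brace H hH)).ker) : (Subtype.val g).right = 1 := by
  ext x
  obtain ⟨k, rfl⟩ := (psi (hH := hH)).surjective x
  rw [← psi_lam]
  exact congrArg psi (DFunLike.congr_fun (MonoidHom.mem_ker.1 hg) (Multiplicative.ofAdd k))

end Hol.Brace

theorem M1.card_ker_lam_kerOne {p : ℕ} [Fact p.Prime] (hp : 3 < p) (s t : ZMod p)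
    (h : Hol.IsRegular (M1.kerOneSubgroup hp s t)) :
    Nat.card (SkewBrace.lam (Hol.Brace _ h)).ker = 1 := by
  rw [Subgroup.card_eq_one, Subgroup.eq_bot_iff_forall]
  intro g hg
  obtain ⟨u, rfl⟩ := (kerOneEquiv hp s t h).surjective g
  have h1 := Hol.Brace.right_eq_one_of_mem_ker_lam hg
  rw [val_kerOneEquiv] at h1
  have : u = 1 := unip_injective hp (by rw [map_one]; exact h1)
  rw [this, map_one]

/-! ### The socle as `ker λ ∩ Z (B, +)`, and the commutator argument. -/

namespace SkewBrace

variable {B : Type*} [SkewBrace B]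

/-- `λ_a (b) = -a + a * b` as an operation on `B` itself. -/
def lamFun (a b : B) : B := -a + a * b

theorem mul_eq_add_lamFun (a b : B) : a * b = a + lamFun a b := by simp [lamFun]

theorem lamFun_add (a b c : B) : lamFun a (b + c) = lamFun a b + lamFun a c :=
  (lam B a).map_mul (Multiplicative.ofAdd b) (Multiplicative.ofAdd c)

theorem lamFun_mul (a b c : B) : lamFun (a * b) c = lamFun a (lamFun b c) := lam_mul a b c

theorem lamFun_one (c : B) : lamFun 1 c = c := by simp [lamFun, one_eq_zero]

theorem lamFun_injective (a : B) : Function.Injective (lamFun a) :=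
  fun _ _ h => (lam B a).injective h

theorem lamFun_zero (a : B) : lamFun a 0 = 0 := (lam B a).map_one

theorem mem_ker_lam_iff {a : B} : a ∈ (lam B).ker ↔ ∀ b, lamFun a b = b := by
  rw [MonoidHom.mem_ker]
  exact ⟨fun h b => DFunLike.congr_fun h (Multiplicative.ofAdd b), fun h => by ext b; exact h b⟩

theorem lamFun_inv_self (a : B) : lamFun a a⁻¹ = -a := by
  simp [lamFun, one_eq_zero]

theorem lamFun_mem_center {z : B} (a : B) (hz : z ∈ AddSubgroup.center B) :
    lamFun a z ∈ AddSubgroup.center B := by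
  rw [AddSubgroup.mem_center_iff] at hz ⊢
  intro g
  have hg : g = lamFun a (lamFun a⁻¹ g) := by rw [← lamFun_mul, mul_inv_cancel, lamFun_one]
  rw [hg, ← lamFun_add, ← lamFun_add, hz]

theorem socle_eq : socle B = {a | a ∈ (lam B).ker ∧ a ∈ AddSubgroup.center B} := by
  ext a
  simp only [socle, Set.mem_ofPred_eq]
  have hadd : ∀ b, a + b = a * b ↔ lamFun a b = b := by
    intro b
    rw [mul_eq_add_lamFun, add_right_inj, eq_comm]
  have hcomm : ∀ b, b + b * a = b * a + b ↔ b + lamFun b a = lamFun b a + b := by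
    intro b
    rw [mul_eq_add_lamFun, add_assoc, add_right_inj]
  simp only [hadd, hcomm, forall_and, mem_ker_lam_iff]
  refine and_congr_right fun _ => ?_
  rw [AddSubgroup.mem_center_iff]
  constructor
  · intro h g
    -- This `b` satisfies `λ_b g = b`, so "`b` commutes with `λ_b a`" pulls back along `λ_b` to "`g`
    -- commutes with `a`".
    have h1 := h ((-g)⁻¹)
    set b := (-g)⁻¹ with hb
    have hg : b = lamFun b g := by
      have h2 := lamFun_inv_self b
      rw [hb, inv_inv, ← hb] at h2
      have h3 : lamFun b (-g) = - lamFun b g := (lam B b).map_inv (Multiplicative.ofAdd g)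
      rw [h3, neg_inj] at h2
      exact h2.symm
    rw [hg, ← hg] at h1
    have h4 : lamFun b g + lamFun b a = lamFun b a + lamFun b g := by rw [← hg]; exact h1
    rw [← lamFun_add, ← lamFun_add] at h4
    exact lamFun_injective b h4
  · intro h b
    exact AddSubgroup.mem_center_iff.1
      (lamFun_mem_center b (AddSubgroup.mem_center_iff.2 h)) b

theorem add_mem_ker_lam {a b : B} (ha : a ∈ (lam B).ker) (hb : b ∈ (lam B).ker) :
    a + b ∈ (lam B).ker := by
  have : a + b = a * b := by rw [mul_eq_add_lamFun, mem_ker_lam_iff.1 ha]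
  rw [this]
  exact mul_mem ha hb

theorem neg_mem_ker_lam {a : B} (ha : a ∈ (lam B).ker) : -a ∈ (lam B).ker := by
  have : -a = a⁻¹ := by rw [← lamFun_inv_self, mem_ker_lam_iff.1 ha]
  rw [this]
  exact inv_mem ha

/-- If the image of `λ` is abelian, `λ` fixes `Z (B, +)` pointwise, `Z (B, +)` meets `ker λ`
trivially and contains all additive commutators, then `Z (B, +)` is contained in `ker λ`. -/
theorem mem_ker_lam_of_commute
    (hfix : ∀ a z : B, z ∈ AddSubgroup.center B → lamFun a z = z)
    (hab : ∀ a b : B, lam B a * lam B b = lam B b * lam B a)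
    (hcomm : ∀ a b : B, a + b + -a + -b ∈ AddSubgroup.center B)
    (hdisj : ∀ a ∈ AddSubgroup.center B, a ∈ (lam B).ker → a = 0)
    {z : B} (hz : z ∈ AddSubgroup.center B) : z ∈ (lam B).ker := by
  have hu : ∀ c, lamFun z c + -c ∈ (lam B).ker := by
    intro c
    -- The multiplicative commutator `k` dies in the abelian image of `λ`. Expanding `k * (c * z) =
    -- z * c` additively, with `z` central and fixed, gives `k = λ_z c - c`.
    have hk : z * c * (c * z)⁻¹ ∈ (lam B).ker := by
      rw [MonoidHom.mem_ker, map_mul, map_inv, map_mul, map_mul, hab, mul_inv_cancel]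
    set k := z * c * (c * z)⁻¹ with hkdef
    have h1 : k * (c * z) = z * c := by rw [hkdef, inv_mul_cancel_right]
    rw [mul_eq_add_lamFun k, mem_ker_lam_iff.1 hk, mul_eq_add_lamFun c, hfix c z hz,
      mul_eq_add_lamFun z, AddSubgroup.mem_center_iff.1 hz c,
      ← AddSubgroup.mem_center_iff.1 hz (lamFun z c),
      ← AddSubgroup.mem_center_iff.1 hz c, ← add_assoc, add_left_inj] at h1
    rw [← h1, add_neg_cancel_right]
    exact hk
  rw [mem_ker_lam_iff]
  intro d
  have hcent : lamFun z d + -d ∈ AddSubgroup.center B := by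
    rw [AddSubgroup.mem_center_iff]
    intro c
    -- Comparing the differences at `c` and at `c + d` shows that the conjugate of `λ_z d - d` by
    -- `c` is again in `ker λ`. The additive commutator of the two is then central and in `ker λ`,
    -- hence zero.
    have h1 : c + (lamFun z d + -d) + -c ∈ (lam B).ker := by
      have h2 : c + (lamFun z d + -d) + -c =
          -(lamFun z c + -c) + (lamFun z (c + d) + -(c + d)) := by
        rw [lamFun_add]
        simp only [neg_add_rev, neg_neg, add_assoc, neg_add_cancel_left]
      rw [h2]
      exact add_mem_ker_lam (neg_mem_ker_lam (hu c)) (hu _)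
    have h3 := hdisj _ (hcomm c (lamFun z d + -d))
      (add_mem_ker_lam h1 (neg_mem_ker_lam (hu d)))
    rw [add_neg_eq_zero, add_neg_eq_iff_eq_add] at h3
    exact h3
  have := hdisj _ hcent (hu d)
  rwa [add_neg_eq_zero] at this

end SkewBrace

/-! ### Socle and annihilator of skew braces of `M₁` type. -/

namespace SkewBrace

variable {B : Type*} [SkewBrace B] {p : ℕ} [Fact p.Prime]

omit [Fact p.Prime] in
theorem natCard_of_equiv (φ : Multiplicative B ≃* M1 p) : Nat.card B = p ^ 3 := by
  rw [← M1.natCard p]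
  exact Nat.card_congr (Multiplicative.ofAdd.trans φ.toEquiv)

theorem card_ker_lam_dvd (φ : Multiplicative B ≃* M1 p) :
    ∃ k ≤ 3, Nat.card (lam B).ker = p ^ k := by
  have h := Subgroup.card_subgroup_dvd_card (lam B).ker
  rw [natCard_of_equiv φ] at h
  exact (Nat.dvd_prime_pow Fact.out).1 h

omit [Fact p.Prime] in
theorem mem_center_iff_map (φ : Multiplicative B ≃* M1 p) {z : B} :
    z ∈ AddSubgroup.center B ↔ φ (Multiplicative.ofAdd z) ∈ Subgroup.center (M1 p) := by
  rw [AddSubgroup.mem_center_iff, Subgroup.mem_center_iff]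
  constructor
  · intro h g
    obtain ⟨b, rfl⟩ := φ.surjective g
    rw [← map_mul, ← map_mul]
    exact congrArg φ (congrArg Multiplicative.ofAdd (h b.toAdd))
  · intro h g
    have := h (φ (Multiplicative.ofAdd g))
    rw [← map_mul φ, ← map_mul φ] at this
    exact φ.injective this

/-- The permutation action of the multiplicative group on the additive centre. -/
@[reducible] def centerAction (B : Type*) [SkewBrace B] : MulAction B (AddSubgroup.center B) where
  smul a z := ⟨lamFun a z, lamFun_mem_center a z.2⟩
  one_smul _ := Subtype.ext (lamFun_one _)
  mul_smul a b z := Subtype.ext (lamFun_mul a b z)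

theorem natCard_center (φ : Multiplicative B ≃* M1 p) : Nat.card (AddSubgroup.center B) = p := by
  have e : AddSubgroup.center B ≃ Subgroup.center (M1 p) :=
    (Multiplicative.ofAdd.trans φ.toEquiv).subtypeEquiv fun z => mem_center_iff_map φ
  have e2 : Subgroup.center (M1 p) ≃ ZMod p :=
    { toFun := fun x => x.1.r
      invFun := fun r => ⟨⟨r, 0, 0⟩, M1.mem_center_iff.2 ⟨rfl, rfl⟩⟩
      left_inv := fun x => by
        obtain ⟨h1, h2⟩ := M1.mem_center_iff.1 x.2
        apply Subtype.ext
        ext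
        · rfl
        · exact h1.symm
        · exact h2.symm
      right_inv := fun r => rfl }
  rw [Nat.card_congr (e.trans e2), Nat.card_zmod]

omit [Fact p.Prime] in
theorem isPGroup_of_equiv (φ : Multiplicative B ≃* M1 p) : IsPGroup p B :=
  IsPGroup.of_card (natCard_of_equiv φ)

/-- The p-group `(B, *)` acts on a set of `p` elements. The number of fixed points is a multiple of
`p`, and positive because `0` is fixed, so every point is fixed. -/
theorem lamFun_eq_of_mem_center (φ : Multiplicative B ≃* M1 p) (a : B) {z : B}
    (hz : z ∈ AddSubgroup.center B) : lamFun a z = z := by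
  let := centerAction B
  have hc := natCard_center φ
  have hp : p.Prime := Fact.out
  have : Finite (AddSubgroup.center B) := Nat.finite_of_card_ne_zero (hc ▸ hp.ne_zero)
  have h := (isPGroup_of_equiv φ).card_modEq_card_fixedPoints (AddSubgroup.center B)
  rw [hc, Nat.ModEq, Nat.mod_self, eq_comm, ← Nat.dvd_iff_mod_eq_zero] at h
  have h0 : (0 : AddSubgroup.center B) ∈ MulAction.fixedPoints B (AddSubgroup.center B) :=
    fun b => Subtype.ext (lamFun_zero b)
  have hne : Nonempty (MulAction.fixedPoints B (AddSubgroup.center B)) := ⟨⟨0, h0⟩⟩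
  have hle := Nat.le_of_dvd Nat.card_pos h
  have hu : MulAction.fixedPoints B (AddSubgroup.center B) = Set.univ := by
    apply Set.eq_of_subset_of_ncard_le (Set.subset_univ _)
    rw [Set.ncard_univ, hc]
    exact hle
  have hmem : (⟨z, hz⟩ : AddSubgroup.center B) ∈
      MulAction.fixedPoints B (AddSubgroup.center B) := hu ▸ Set.mem_univ _
  exact congrArg Subtype.val (hmem a)

omit [Fact p.Prime] in
theorem add_comm_mem_center (φ : Multiplicative B ≃* M1 p) (a b : B) :
    a + b + -a + -b ∈ AddSubgroup.center B := by
  rw [mem_center_iff_map φ]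
  have := M1.commutator_mem_center (φ (Multiplicative.ofAdd a)) (φ (Multiplicative.ofAdd b))
  rw [← map_inv φ, ← map_inv φ, ← map_mul φ, ← map_mul φ, ← map_mul φ] at this
  exact this

/-- The image of `λ` has order `p ^ 2`, `p` or `1`, and groups of these orders are abelian. -/
theorem lam_commute_of_card_ker (φ : Multiplicative B ≃* M1 p)
    (hk : Nat.card (lam B).ker ≠ 1) (a b : B) : lam B a * lam B b = lam B b * lam B a := by
  have hp : p.Prime := Fact.out
  obtain ⟨k, hk3, hcard⟩ := card_ker_lam_dvd φ
  have hmul := Subgroup.card_mul_index (lam B).ker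
  rw [natCard_of_equiv φ, Subgroup.index_ker, hcard] at hmul
  have hk0 : k ≠ 0 := by rintro rfl; exact hk (by rw [hcard, pow_zero])
  have hrange : Nat.card (lam B).range = p ^ (3 - k) := by
    apply Nat.eq_of_mul_eq_mul_left (pow_pos hp.pos k)
    rw [hmul, ← pow_add, Nat.add_sub_cancel' hk3]
  have hcomm : ∀ x y : (lam B).range, x * y = y * x := by
    have h : k = 1 ∨ k = 2 ∨ k = 3 := by omega
    rcases h with rfl | rfl | rfl
    · have := IsPGroup.isMulCommutative_of_card_eq_prime_sq hrange
      exact fun x y => mul_comm' x y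
    · have : IsCyclic (lam B).range := isCyclic_of_prime_card (p := p) (by simpa using hrange)
      let := IsCyclic.commGroup (α := (lam B).range)
      exact fun x y => mul_comm x y
    · have : Subsingleton (lam B).range := (Nat.card_eq_one_iff_unique.1 (by simpa using hrange)).1
      exact fun x y => Subsingleton.elim _ _
  exact congrArg Subtype.val (hcomm ⟨lam B a, a, rfl⟩ ⟨lam B b, b, rfl⟩)

theorem center_le_ker_lam (φ : Multiplicative B ≃* M1 p) (hk : Nat.card (lam B).ker ≠ 1)
    {z : B} (hz : z ∈ AddSubgroup.center B) : z ∈ (lam B).ker := by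
  by_cases hdisj : ∀ a ∈ AddSubgroup.center B, a ∈ (lam B).ker → a = 0
  · exact mem_ker_lam_of_commute (fun a z hz => lamFun_eq_of_mem_center φ a hz)
      (lam_commute_of_card_ker φ hk) (add_comm_mem_center φ) hdisj hz
  · push Not at hdisj
    obtain ⟨a, ha, hak, ha0⟩ := hdisj
    have hp : p.Prime := Fact.out
    -- On `ker λ` sums are products, so `ker λ` cuts out an additive subgroup of the centre; prime
    -- order makes it everything once it is nonzero.
    let K : AddSubgroup (AddSubgroup.center B) :=
      { carrier := {x | (x : B) ∈ (lam B).ker}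
        zero_mem' := by
          change (0 : B) ∈ (lam B).ker
          rw [← one_eq_zero]; exact one_mem _
        add_mem' := fun hx hy => add_mem_ker_lam hx hy
        neg_mem' := fun hx => neg_mem_ker_lam hx }
    have hc := natCard_center φ
    have : Fact (Nat.card (AddSubgroup.center B)).Prime := ⟨hc ▸ hp⟩
    rcases AddSubgroup.eq_bot_or_eq_top_of_prime_card K with h | h
    · have : (⟨a, ha⟩ : AddSubgroup.center B) ∈ K := hak
      rw [h, AddSubgroup.mem_bot] at this
      exact absurd (congrArg Subtype.val this) ha0
    · have : (⟨z, hz⟩ : AddSubgroup.center B) ∈ K := h ▸ AddSubgroup.mem_top _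
      exact this

theorem socle_eq_center (φ : Multiplicative B ≃* M1 p) (hk : Nat.card (lam B).ker ≠ 1) :
    socle B = (AddSubgroup.center B : Set B) := by
  rw [socle_eq]
  ext a
  exact ⟨fun h => h.2, fun h => ⟨center_le_ker_lam φ hk h, h⟩⟩

theorem annihilator_eq_center (φ : Multiplicative B ≃* M1 p)
    (hk : Nat.card (lam B).ker ≠ 1) : annihilator B = (AddSubgroup.center B : Set B) := by
  rw [annihilator, socle_eq_center φ hk, Set.inter_eq_left]
  intro z hz
  refine Subgroup.mem_center_iff.2 fun c => ?_
  rw [mul_eq_add_lamFun, mul_eq_add_lamFun, lamFun_eq_of_mem_center φ c hz,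
    mem_ker_lam_iff.1 (center_le_ker_lam φ hk hz), AddSubgroup.mem_center_iff.1 hz]

theorem center_eq_preimage (φ : Multiplicative B ≃* M1 p) :
    (AddSubgroup.center B : Set B) =
      {b | φ (Multiplicative.ofAdd b) ∈ Subgroup.zpowers M1.rho} := by
  ext z
  rw [Set.mem_ofPred_eq, M1.zpowers_rho_eq_center]
  exact mem_center_iff_map φ

theorem socle_eq_singleton (hk : Nat.card (lam B).ker = 1) : socle B = {0} := by
  rw [Subgroup.card_eq_one] at hk
  rw [socle_eq, hk]
  ext a
  simp only [Subgroup.mem_bot, Set.mem_ofPred_eq, Set.mem_singleton_iff, one_eq_zero]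
  exact ⟨fun h => h.1, fun h => ⟨h, h ▸ zero_mem _⟩⟩

theorem annihilator_eq_singleton (hk : Nat.card (lam B).ker = 1) : annihilator B = {0} := by
  rw [annihilator, socle_eq_singleton hk, Set.inter_eq_left, Set.singleton_subset_iff,
    ← one_eq_zero]
  exact one_mem _

theorem isTrivial_of_card_ker (φ : Multiplicative B ≃* M1 p)
    (h : Nat.card (lam B).ker = p ^ 3) : IsTrivial B := by
  have hp : p.Prime := Fact.out
  have : Finite B := Nat.finite_of_card_ne_zero
    (natCard_of_equiv φ ▸ pow_ne_zero 3 hp.ne_zero)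
  have ht : (lam B).ker = ⊤ := Subgroup.eq_top_of_card_eq _ (by rw [h, natCard_of_equiv φ])
  intro a b
  rw [mul_eq_add_lamFun, mem_ker_lam_iff.1 (ht ▸ Subgroup.mem_top a)]

theorem IsAnnihilatorExtension.subsingleton {A Q : Type*} [SkewBrace A] [SkewBrace Q]
    {i : A → B} {q : B → Q} (hk : Nat.card (lam B).ker = 1)
    (h : IsAnnihilatorExtension i q) : Subsingleton A := by
  refine ⟨fun x y => h.injective ?_⟩
  have h1 := h.range_subset
  rw [annihilator_eq_singleton hk] at h1
  have hx : i x = 0 := h1 ⟨x, rfl⟩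
  have hy : i y = 0 := h1 ⟨y, rfl⟩
  rw [hx, hy]

end SkewBrace

/-! ### Automorphisms of `M₁` and their action modulo the centre. -/

namespace M1

variable {p : ℕ} [Fact p.Prime]

/-- The automorphism of `M1 p` that acts on the coordinates `s, t` by the invertible matrix
`!![a, b; c, d]`. -/
def linAut (hp : 3 < p) (a b c d : ZMod p) (hD : a * d - b * c ≠ 0) : MulAut (M1 p) where
  -- In the coordinate `r - s t / 2` the cocycle of the group law becomes the alternating form `(t₁
  -- s₂ - s₁ t₂) / 2`, which the matrix scales by its determinant.
  toFun x := ⟨(a * d - b * c) * (x.r - x.s * x.t / 2) +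
    (a * x.s + b * x.t) * (c * x.s + d * x.t) / 2, a * x.s + b * x.t, c * x.s + d * x.t⟩
  invFun x := ⟨(x.r - x.s * x.t / 2) / (a * d - b * c) +
    (d * x.s - b * x.t) * (a * x.t - c * x.s) / (2 * (a * d - b * c) ^ 2),
    (d * x.s - b * x.t) / (a * d - b * c), (a * x.t - c * x.s) / (a * d - b * c)⟩
  left_inv x := by
    have h2 := two_ne_zero' hp
    ext
    · simp only; field_simp; ring
    · simp only; rw [div_eq_iff hD]; ring
    · simp only; rw [div_eq_iff hD]; ring
  right_inv x := by
    have h2 := two_ne_zero' hp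
    ext
    · simp only; field_simp; ring
    · simp only; rw [mul_div_assoc', mul_div_assoc', ← add_div, div_eq_iff hD]; ring
    · simp only; rw [mul_div_assoc', mul_div_assoc', ← add_div, div_eq_iff hD]; ring
  map_mul' x y := by
    have h2 := two_ne_zero' hp
    ext
    · simp only [mul_r, mul_s, mul_t]; field_simp; ring
    · simp; ring
    · simp; ring

theorem apply_rho_s (θ : MulAut (M1 p)) : (θ rho).s = 0 ∧ (θ rho).t = 0 := by
  rw [← mem_center_iff, Subgroup.mem_center_iff]
  intro g
  obtain ⟨g, rfl⟩ := θ.surjective g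
  rw [← map_mul, ← map_mul, Subgroup.mem_center_iff.1 (mem_center_iff.2 ⟨rfl, rfl⟩) g]

theorem apply_eq (θ : MulAut (M1 p)) (x : M1 p) :
    θ x = θ rho ^ x.r.val * θ sigma ^ x.s.val * θ tau ^ x.t.val := by
  conv_lhs => rw [eq_pow_mul_pow_mul_pow x]
  simp only [map_mul, map_pow]

theorem apply_s (θ : MulAut (M1 p)) (x : M1 p) :
    (θ x).s = x.s * (θ sigma).s + x.t * (θ tau).s := by
  rw [apply_eq θ x]
  simp [(apply_rho_s θ).1]

theorem apply_t (θ : MulAut (M1 p)) (x : M1 p) :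
    (θ x).t = x.s * (θ sigma).t + x.t * (θ tau).t := by
  rw [apply_eq θ x]
  simp [(apply_rho_s θ).2]

theorem tau_mul_sigma : (tau * sigma : M1 p) = rho * sigma * tau := by
  ext <;> simp [rho, sigma, tau]

theorem sigma_mul_rho : (sigma * rho : M1 p) = rho * sigma := by
  ext <;> simp [rho, sigma, add_comm]

theorem tau_mul_rho : (tau * rho : M1 p) = rho * tau := by
  ext <;> simp [rho, tau, add_comm]

/-- `ρ` is the commutator of `τ` and `σ`, and commutators in `M₁` are the determinant of the images
modulo the centre. -/
theorem apply_rho_r (θ : MulAut (M1 p)) :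
    (θ rho).r = (θ tau).t * (θ sigma).s - (θ sigma).t * (θ tau).s := by
  have h := congrArg θ (tau_mul_sigma (p := p))
  simp only [map_mul] at h
  have h := congrArg M1.r h
  simp [apply_rho_s] at h
  linear_combination -h

theorem det_ne_zero (θ : MulAut (M1 p)) :
    (θ tau).t * (θ sigma).s - (θ sigma).t * (θ tau).s ≠ 0 := by
  rw [← apply_rho_r]
  intro h
  have h1 : θ rho = θ 1 := by
    rw [map_one]; ext
    · exact h
    · exact (apply_rho_s θ).1
    · exact (apply_rho_s θ).2
  have := congrArg M1.r (θ.injective h1)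
  exact one_ne_zero this

theorem mulAut_ext {θ θ' : MulAut (M1 p)} (hr : θ rho = θ' rho) (hs : θ sigma = θ' sigma)
    (ht : θ tau = θ' tau) : θ = θ' := by
  have : θ.toMonoidHom = θ'.toMonoidHom := monoidHom_ext hr hs ht
  ext1 x
  exact DFunLike.congr_fun this x

/-- Fixing `ρ` means determinant `1`; together with `τ` fixed modulo the centre this makes `σ`
change only by powers of `τ` and `ρ`, which supply the three parameters. -/
theorem mem_range_unip (hp : 3 < p) {θ : MulAut (M1 p)} (hr : θ rho = rho)
    (hs : (θ tau).s = 0) (ht : (θ tau).t = 1) : ∃ u, unip hp u = θ := by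
  have h1 := apply_rho_r θ
  rw [hr, hs, ht, mul_zero, sub_zero, one_mul] at h1
  have h1 : (θ sigma).s = 1 := h1.symm
  refine ⟨⟨(θ sigma).r, (θ sigma).t, (θ tau).r⟩, mulAut_ext ?_ ?_ ?_⟩
  · rw [hr]; ext <;> simp [unip_apply, rho]
  · rw [M1.ext_iff, h1]; simp [unip_apply, sigma]
  · rw [M1.ext_iff, hs, ht]; simp [unip_apply, tau]

/-- A `p`-group of automorphisms of `M1 p` fixes a line modulo the centre. -/
theorem exists_fixed_mod_center {G : Type*} [Group G] (hG : IsPGroup p G)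
    (Λ : G →* MulAut (M1 p)) :
    ∃ x y : ZMod p, (x ≠ 0 ∨ y ≠ 0) ∧ ∀ g, (Λ g ⟨0, x, y⟩).s = x ∧ (Λ g ⟨0, x, y⟩).t = y := by
  let act : MulAction G (ZMod p × ZMod p) :=
    { smul := fun g v => ((Λ g ⟨0, v.1, v.2⟩).s, (Λ g ⟨0, v.1, v.2⟩).t)
      one_smul := fun v => by
        change ((Λ 1 ⟨0, v.1, v.2⟩).s, (Λ 1 ⟨0, v.1, v.2⟩).t) = v
        rw [map_one]; rfl
      mul_smul := fun g h v => by
        change ((Λ (g * h) ⟨0, v.1, v.2⟩).s, (Λ (g * h) ⟨0, v.1, v.2⟩).t) =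
          ((Λ g ⟨0, (Λ h ⟨0, v.1, v.2⟩).s, (Λ h ⟨0, v.1, v.2⟩).t⟩).s,
            (Λ g ⟨0, (Λ h ⟨0, v.1, v.2⟩).s, (Λ h ⟨0, v.1, v.2⟩).t⟩).t)
        rw [map_mul, MulAut.mul_apply, apply_s (Λ g) (Λ h _), apply_t (Λ g) (Λ h _),
          apply_s (Λ g) ⟨0, _, _⟩, apply_t (Λ g) ⟨0, _, _⟩] }
  have hcard : p ∣ Nat.card (ZMod p × ZMod p) := by
    rw [Nat.card_prod, Nat.card_zmod]; exact dvd_mul_right _ _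
  have h0 : (0 : ZMod p × ZMod p) ∈ MulAction.fixedPoints G (ZMod p × ZMod p) := by
    intro g
    change ((Λ g 1).s, (Λ g 1).t) = 0
    rw [map_one]; rfl
  -- The zero vector is fixed and `p` divides `p ^ 2`, so a second fixed vector exists.
  obtain ⟨v, hv, hne⟩ :=
    hG.exists_fixed_point_of_prime_dvd_card_of_fixed_point (ZMod p × ZMod p) hcard h0
  refine ⟨v.1, v.2, ?_, fun g => ?_⟩
  · by_contra! h
    exact hne (Prod.ext h.1.symm h.2.symm)
  · have := hv g
    exact ⟨congrArg Prod.fst this, congrArg Prod.snd this⟩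

end M1

/-! ### Unipotent frames and their crossed homomorphisms. -/

/-- An identification of a skew brace `B` with `M1 p`, for both group structures, under which
`λ` becomes `M1.unip`. -/
structure UnipotentFrame (B : Type*) [SkewBrace B] {p : ℕ} [Fact p.Prime] (hp : 3 < p) where
  addEquiv : Multiplicative B ≃* M1 p
  mulEquiv : M1 p ≃* B
  intertwine : ∀ u b, addEquiv (Multiplicative.ofAdd (SkewBrace.lamFun (mulEquiv u) b)) =
    M1.unip hp u (addEquiv (Multiplicative.ofAdd b))

namespace UnipotentFrame

open M1

variable {B : Type*} [SkewBrace B] {p : ℕ} [Fact p.Prime] {hp : 3 < p}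

/-- The bijective crossed homomorphism of a frame. -/
def pi (F : UnipotentFrame B hp) (u : M1 p) : M1 p :=
  F.addEquiv (Multiplicative.ofAdd (F.mulEquiv u))

theorem pi_bijective (F : UnipotentFrame B hp) : Function.Bijective F.pi :=
  F.addEquiv.bijective.comp (Multiplicative.ofAdd.bijective.comp F.mulEquiv.bijective)

theorem pi_mul (F : UnipotentFrame B hp) (u v : M1 p) :
    F.pi (u * v) = F.pi u * unip hp u (F.pi v) := by
  rw [pi, map_mul, SkewBrace.mul_eq_add_lamFun, ofAdd_add, map_mul, F.intertwine]
  rfl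

/-- The hom `u ↦ (π u, unip u)` to the holomorph. -/
def hom (F : UnipotentFrame B hp) : M1 p →* Hol (M1 p) :=
  MonoidHom.mk' (fun u => ⟨F.pi u, unip hp u⟩) fun u v => by
    apply SemidirectProduct.ext
    · exact F.pi_mul u v
    · exact map_mul _ u v

/-- Change of frame along compatible automorphisms. -/
def change (F : UnipotentFrame B hp) (θ ω : MulAut (M1 p))
    (h : ∀ u x, θ (unip hp u x) = unip hp (ω u) (θ x)) : UnipotentFrame B hp where
  addEquiv := F.addEquiv.trans θ
  mulEquiv := MulEquiv.trans ω.symm F.mulEquiv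
  intertwine u b := by
    have := h (ω.symm u) (F.addEquiv (Multiplicative.ofAdd b))
    rw [← F.intertwine, MulEquiv.apply_symm_apply] at this
    exact this

theorem pi_change (F : UnipotentFrame B hp) (θ ω : MulAut (M1 p))
    (h : ∀ u x, θ (unip hp u x) = unip hp (ω u) (θ x)) (u : M1 p) :
    (F.change θ ω h).pi (ω u) = θ (F.pi u) := by
  change θ (F.addEquiv (Multiplicative.ofAdd (F.mulEquiv (ω.symm (ω u))))) = _
  rw [MulEquiv.symm_apply_apply]; rfl

theorem pi_eq_cocycle (F : UnipotentFrame B hp) {s t : ZMod p} (hr : F.pi rho = ⟨0, 0, -2⟩)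
    (hs : F.pi sigma = ⟨s, 0, 1⟩) (ht : F.pi tau = ⟨0, 2, t⟩) (u : M1 p) :
    F.pi u = cocycle s t u := by
  have h : F.hom = kerOneHom hp s t := by
    apply monoidHom_ext
    · apply SemidirectProduct.ext
      · change F.pi rho = _
        rw [hr]; ext <;> simp [kerOneHom, cocycle, rho]
      · rfl
    · apply SemidirectProduct.ext
      · change F.pi sigma = _
        rw [hs]; ext <;> simp [kerOneHom, cocycle, sigma]
      · rfl
    · apply SemidirectProduct.ext
      · change F.pi tau = _
        rw [ht]; ext <;> simp [kerOneHom, cocycle, tau]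
      · rfl
  exact congrArg SemidirectProduct.left (DFunLike.congr_fun h u)

/-- Each relation of `M₁`, written out through `pi_mul`, is a system of equations in the coordinates
of the three values; surjectivity of `π` removes the degenerate solution. -/
theorem pi_generators (F : UnipotentFrame B hp) :
    (F.pi rho).s = 0 ∧ (F.pi rho).t = -2 ∧ (F.pi sigma).s = 0 ∧ (F.pi tau).s = 2 ∧
      (F.pi rho).r = 1 - (F.pi sigma).t := by
  have h2 := two_ne_zero' hp
  have e1 := congrArg F.pi (tau_mul_sigma (p := p))
  have e2 := congrArg F.pi (sigma_mul_rho (p := p))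
  have e3 := congrArg F.pi (tau_mul_rho (p := p))
  simp only [pi_mul] at e1 e2 e3
  -- Since `unip` fixes the `s` coordinate, `u ↦ (π u).s` is additive; vanishing on generators would
  -- make it vanish identically.
  have hsurj : ¬ ((F.pi rho).s = 0 ∧ (F.pi sigma).s = 0 ∧ (F.pi tau).s = 0) := by
    rintro ⟨h1, h3, h4⟩
    have h0 : ∀ u ∈ (⊤ : Subgroup (M1 p)), (F.pi u).s = 0 := by
      rw [← closure_eq_top]
      intro u hu
      have hone : (F.pi 1).s = 0 := by
        have := congrArg M1.s (F.pi_mul 1 1)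
        simp at this
        exact this
      induction hu using Subgroup.closure_induction with
      | mem x hx => rcases hx with rfl | rfl | rfl <;> assumption
      | one => exact hone
      | mul x y _ _ hx hy => rw [pi_mul]; simp [unip_apply, hx, hy]
      | inv x _ hx =>
        have := congrArg M1.s (F.pi_mul x x⁻¹)
        rw [mul_inv_cancel, hone] at this
        simp [unip_apply, hx] at this
        exact this.symm
    obtain ⟨u, hu⟩ := F.pi_bijective.2 sigma
    have := h0 u (Subgroup.mem_top u)
    rw [hu] at this
    exact one_ne_zero this
  generalize F.pi rho = z at *
  generalize F.pi sigma = x at *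
  generalize F.pi tau = y at *
  obtain ⟨z1, z2, z3⟩ := z
  obtain ⟨x1, x2, x3⟩ := x
  obtain ⟨y1, y2, y3⟩ := y
  simp only [M1.ext_iff, unip_apply, rho, sigma, tau, mul_r, mul_s, mul_t] at e1 e2 e3 hsurj ⊢
  obtain ⟨e1r, e1s, e1t⟩ := e1
  obtain ⟨e2r, e2s, e2t⟩ := e2
  obtain ⟨e3r, e3s, e3t⟩ := e3
  have hz2 : z2 = 0 := by linear_combination -e1s
  subst hz2
  have hz3 : z3 = -y2 := by linear_combination -e1t
  subst hz3
  have hx : x2 * (1 - y2) = 0 := by linear_combination -e2r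
  have hy : y2 * (y2 - 2) = 0 := by linear_combination e3r
  have hy2 : y2 = 2 := by
    rcases mul_eq_zero.1 hy with h | h
    · subst h
      exact absurd ⟨rfl, by simpa using hx, rfl⟩ hsurj
    · exact sub_eq_zero.1 h
  subst hy2
  have hx2 : x2 = 0 := by linear_combination -hx
  subst hx2
  refine ⟨rfl, rfl, rfl, rfl, ?_⟩
  have hq : (2 : ZMod p) * (2 - 1) / 2 = 1 := by field_simp; ring
  linear_combination -e1r - hq

end UnipotentFrame

/-! ### Normalisation of the parameters. -/

namespace UnipotentFrame

open M1

variable {B : Type*} [SkewBrace B] {p : ℕ} [Fact p.Prime] {hp : 3 < p}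

/-- Change of frame by `unip v`. -/
def changeUnip (F : UnipotentFrame B hp) (v : M1 p) : UnipotentFrame B hp :=
  F.change (unip hp v) (MulAut.conj v) fun u x => by
    rw [MulAut.conj_apply, ← MulAut.mul_apply, ← MulAut.mul_apply, ← map_mul, ← map_mul,
      inv_mul_cancel_right]

theorem pi_changeUnip (F : UnipotentFrame B hp) (v u : M1 p) :
    (F.changeUnip v).pi u = unip hp v (F.pi (v⁻¹ * u * v)) := by
  rw [changeUnip]
  conv_lhs => rw [show u = MulAut.conj v (v⁻¹ * u * v) by rw [MulAut.conj_apply]; group]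
  exact pi_change _ _ _ _ _

theorem pi_changeUnip_center (F : UnipotentFrame B hp) (k : ZMod p) (u : M1 p) :
    (F.changeUnip ⟨k, 0, 0⟩).pi u =
      ⟨(F.pi u).r + k * (F.pi u).s, (F.pi u).s, (F.pi u).t⟩ := by
  have h : (⟨k, 0, 0⟩ : M1 p)⁻¹ * u * ⟨k, 0, 0⟩ = u := by ext <;> simp
  rw [pi_changeUnip, h]
  simp [unip_apply]

theorem exists_pi_rho_r (F : UnipotentFrame B hp) :
    ∃ F' : UnipotentFrame B hp, (F'.pi rho).r = 0 := by
  have h2 := two_ne_zero' hp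
  obtain ⟨h1, h3, -⟩ := F.pi_generators
  -- Conjugation by `α₃^h` adds `h * (-2)` to the first coordinate of `π ρ`.
  refine ⟨F.changeUnip ⟨0, 0, (F.pi rho).r / 2⟩, ?_⟩
  rw [pi_changeUnip]
  have : (⟨0, 0, (F.pi rho).r / 2⟩ : M1 p)⁻¹ * rho * ⟨0, 0, (F.pi rho).r / 2⟩ = rho := by
    ext <;> simp [rho]
  rw [this]
  simp [unip_apply, h1, h3, div_mul_cancel₀ _ h2]

theorem exists_pi_eq_cocycle (F : UnipotentFrame B hp) :
    ∃ (F' : UnipotentFrame B hp) (s t : ZMod p), ∀ u, F'.pi u = cocycle s t u := by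
  have h2 := two_ne_zero' hp
  obtain ⟨F, hF⟩ := F.exists_pi_rho_r
  obtain ⟨h1, h3, h4, h5, h6⟩ := F.pi_generators
  have h7 : (F.pi sigma).t = 1 := by rw [hF] at h6; linear_combination h6
  -- A central conjugation adds a multiple of the `s` coordinate, which is nonzero only at `π τ`,
  -- where it is `2`; so only `π τ` changes.
  refine ⟨F.changeUnip ⟨-(F.pi tau).r / 2, 0, 0⟩, (F.pi sigma).r, (F.pi tau).t,
    pi_eq_cocycle _ ?_ ?_ ?_⟩
  all_goals
    rw [pi_changeUnip_center, M1.ext_iff]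
    simp [hF, h1, h3, h4, h5, h7, div_mul_cancel₀ _ h2]

/-- Conjugation by `linAut hp a 0 0 d` on the image of `unip`. -/
def diagConj (hp : 3 < p) (a d : ZMod p) (ha : a ≠ 0) (hd : d ≠ 0) : MulAut (M1 p) where
  -- The correction `(d / a - d) / 2` arises because the binomial in `α₂` is not homogeneous under
  -- `s ↦ a s`.
  toFun u := ⟨d * u.r + u.s * (d / a - d) / 2, d / a * u.s, a * u.t⟩
  invFun u := ⟨(u.r - a / d * u.s * (d / a - d) / 2) / d, a / d * u.s, u.t / a⟩
  left_inv u := by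
    have h2 := two_ne_zero' hp
    ext <;> simp only <;> field_simp <;> ring
  right_inv u := by
    have h2 := two_ne_zero' hp
    ext <;> simp only <;> field_simp <;> ring
  map_mul' u v := by
    have h2 := two_ne_zero' hp
    ext <;> simp only [mul_r, mul_s, mul_t] <;> field_simp <;> ring

theorem exists_rescale (F : UnipotentFrame B hp) {s t : ZMod p}
    (hF : ∀ u, F.pi u = cocycle s t u) {a d : ZMod p} (ha : a ≠ 0) (hd : d ≠ 0) :
    ∃ F' : UnipotentFrame B hp, ∀ u, F'.pi u = cocycle (a ^ 2 * s) (d * t / a) u := by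
  have h2 := two_ne_zero' hp
  have hD : a * d - 0 * 0 ≠ 0 := by simp [ha, hd]
  have hcomp : ∀ u x, linAut hp a 0 0 d hD (unip hp u x) =
      unip hp (diagConj hp a d ha hd u) (linAut hp a 0 0 d hD x) := by
    intro u x
    ext <;> simp [linAut, diagConj, unip_apply] <;> field_simp <;> ring
  -- The acting group sends `τ` to `τ^a`, where the new cocycle has first coordinate `3 / 2 * (d t /
  -- a) * (a² - a)`; the preliminary central conjugation produces exactly this term.
  refine ⟨(F.changeUnip ⟨3 / 2 * t * (a - 1) / (2 * a), 0, 0⟩).change (linAut hp a 0 0 d hD)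
    (diagConj hp a d ha hd) hcomp, fun u => ?_⟩
  obtain ⟨u, rfl⟩ := (diagConj hp a d ha hd).surjective u
  rw [pi_change, pi_changeUnip_center, hF]
  ext <;> simp [linAut, diagConj, cocycle] <;> field_simp <;> ring

theorem s_ne_zero (F : UnipotentFrame B hp) {s t : ZMod p}
    (hF : ∀ u, F.pi u = cocycle s t u) : s ≠ 0 := by
  rintro rfl
  -- For `s = 0` the element `ρ σ²` has the same value as the identity, against injectivity.
  have h : F.pi ⟨1, 2, 0⟩ = F.pi 1 := by
    rw [hF, hF]; ext <;> simp [cocycle]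
  have := congrArg M1.r (F.pi_bijective.1 h)
  exact one_ne_zero this

theorem exists_sq_mul_eq {δ s : ZMod p} (hδ : ¬ IsSquare δ) (hs : s ≠ 0) :
    ∃ a : ZMod p, a ≠ 0 ∧ (a ^ 2 * s = 1 ∨ a ^ 2 * s = δ) := by
  have hδ0 : δ ≠ 0 := by rintro rfl; exact hδ (IsSquare.zero)
  by_cases h : IsSquare s
  · obtain ⟨b, rfl⟩ := h
    have hb : b ≠ 0 := by rintro rfl; simp at hs
    exact ⟨b⁻¹, inv_ne_zero hb, Or.inl (by field_simp)⟩
  -- The product of two non-squares of `ZMod p` is a square.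
  · have hsq : IsSquare (δ * s) := by
      by_contra hn
      have e1 := quadraticChar_neg_one_iff_not_isSquare.2 hδ
      have e2 := quadraticChar_neg_one_iff_not_isSquare.2 h
      have e3 := quadraticChar_neg_one_iff_not_isSquare.2 hn
      rw [map_mul, e1, e2] at e3
      norm_num at e3
    obtain ⟨b, hb⟩ := hsq
    have hb0 : b ≠ 0 := by rintro rfl; simp [hδ0, hs] at hb
    refine ⟨b / s, div_ne_zero hb0 hs, Or.inr ?_⟩
    field_simp
    linear_combination -hb

theorem exists_normalized (F : UnipotentFrame B hp) {δ : ZMod p} (hδ : ¬ IsSquare δ) :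
    ∃ (F' : UnipotentFrame B hp) (s t : ZMod p), (s = 1 ∨ s = δ) ∧ (t = 0 ∨ t = 1) ∧
      ∀ u, F'.pi u = cocycle s t u := by
  obtain ⟨F, s, t, hF⟩ := F.exists_pi_eq_cocycle
  obtain ⟨a, ha, has⟩ := exists_sq_mul_eq hδ (F.s_ne_zero hF)
  by_cases ht : t = 0
  · obtain ⟨F', hF'⟩ := F.exists_rescale hF ha one_ne_zero
    exact ⟨F', _, _, has, Or.inl (by simp [ht]), hF'⟩
  · obtain ⟨F', hF'⟩ := F.exists_rescale hF ha (div_ne_zero ha ht)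
    exact ⟨F', _, _, has, Or.inr (by field_simp), hF'⟩

theorem nonempty_ringEquiv (F : UnipotentFrame B hp) {s t : ZMod p}
    (hF : ∀ u, F.pi u = cocycle s t u) (h : Hol.IsRegular (kerOneSubgroup hp s t)) :
    Nonempty (B ≃+* Hol.Brace _ h) := by
  have hpsi : ∀ b, Hol.Brace.psi (kerOneEquiv hp s t h (F.mulEquiv.symm b)) =
      F.addEquiv (Multiplicative.ofAdd b) := by
    intro b
    rw [psi_kerOneEquiv, ← hF, pi, MulEquiv.apply_symm_apply]
  exact ⟨{ F.mulEquiv.symm.trans (kerOneEquiv hp s t h) with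
    map_add' := fun a b => Hol.Brace.psi.injective (by
      change Hol.Brace.psi (kerOneEquiv hp s t h (F.mulEquiv.symm (a + b))) =
        Hol.Brace.psi (kerOneEquiv hp s t h (F.mulEquiv.symm a) +
          kerOneEquiv hp s t h (F.mulEquiv.symm b))
      rw [Hol.Brace.psi_add, hpsi, hpsi, hpsi, ofAdd_add, map_mul]) }⟩

end UnipotentFrame

/-! ### Trivial kernel yields a unipotent frame. -/

namespace SkewBrace

open M1

variable {B : Type*} [SkewBrace B] {p : ℕ} [Fact p.Prime]

/-- The homomorphism `λ` with values in `Aut (M1 p)`. -/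
def lamM1 (φ : Multiplicative B ≃* M1 p) : B →* MulAut (M1 p) :=
  (MulAut.congr φ).toMonoidHom.comp (lam B)

omit [Fact p.Prime] in
theorem lamM1_apply (φ : Multiplicative B ≃* M1 p) (a b : B) :
    lamM1 φ a (φ (Multiplicative.ofAdd b)) = φ (Multiplicative.ofAdd (lamFun a b)) := by
  change φ (lam B a (φ.symm (φ (Multiplicative.ofAdd b)))) = _
  rw [MulEquiv.symm_apply_apply]; rfl

theorem lamM1_rho (φ : Multiplicative B ≃* M1 p) (a : B) : lamM1 φ a rho = rho := by
  obtain ⟨z, hz⟩ := φ.surjective rho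
  have hzc : z.toAdd ∈ AddSubgroup.center B := by
    rw [mem_center_iff_map φ, ofAdd_toAdd, hz]
    exact mem_center_iff.2 ⟨rfl, rfl⟩
  rw [← hz, ← ofAdd_toAdd z, lamM1_apply, lamFun_eq_of_mem_center φ a hzc]

theorem nonempty_unipotentFrame (hp : 3 < p) (φ : Multiplicative B ≃* M1 p)
    (hk : Nat.card (lam B).ker = 1) : Nonempty (UnipotentFrame B hp) := by
  obtain ⟨x, y, hxy, hfix⟩ := exists_fixed_mod_center (isPGroup_of_equiv φ) (lamM1 φ)
  obtain ⟨c, d, hcd⟩ : ∃ c d : ZMod p, c * x + d * y = 1 := by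
    by_cases hx : x = 0
    · exact ⟨0, y⁻¹, by simp [hxy.resolve_left (not_not.2 hx)]⟩
    · exact ⟨x⁻¹, 0, by simp [hx]⟩
  have hD : y * d - (-x) * c ≠ 0 := by
    have : y * d - (-x) * c = 1 := by linear_combination hcd
    rw [this]; exact one_ne_zero
  -- This matrix has determinant `1` and sends the fixed vector `(x, y)` to `(0, 1)`, the class of
  -- `τ`.
  set θ := linAut hp y (-x) c d hD with hθ
  set φ' := φ.trans θ with hφ'
  have hlam : ∀ a m, lamM1 φ' a (θ m) = θ (lamM1 φ a m) := by
    intro a m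
    obtain ⟨b, rfl⟩ := φ.surjective m
    rw [← ofAdd_toAdd b, lamM1_apply φ]
    exact lamM1_apply φ' a b.toAdd
  have hs : ∀ m, (θ m).s = y * m.s + -x * m.t := fun m => rfl
  have ht : ∀ m, (θ m).t = c * m.s + d * m.t := fun m => rfl
  have hrange : ∀ a, ∃ u, unip hp u = lamM1 φ' a := by
    intro a
    have e1 := apply_s (lamM1 φ' a) (θ ⟨0, x, y⟩)
    have e2 := apply_t (lamM1 φ' a) (θ ⟨0, x, y⟩)
    rw [hlam, hs, hs, ht, (hfix a).1, (hfix a).2] at e1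
    rw [hlam, hs, ht, ht, (hfix a).1, (hfix a).2] at e2
    simp only [hcd] at e1 e2
    refine mem_range_unip hp (lamM1_rho φ' a) ?_ ?_
    · linear_combination -e1
    · linear_combination -e2
  choose e he using hrange
  have hinj : Function.Injective e := by
    intro a b hab
    have h1 : lamM1 φ' a = lamM1 φ' b := by rw [← he, ← he, hab]
    have h2 : lam B a = lam B b := (MulAut.congr φ').injective h1
    exact (MonoidHom.ker_eq_bot_iff _).1 (Subgroup.card_eq_one.1 hk) h2
  have : Finite (M1 p) := Finite.of_equiv _ (equivProd p).symm
  -- Trivial kernel gives injectivity, and both sides have `p ^ 3` elements.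
  have hbij : Function.Bijective e := by
    rw [Nat.bijective_iff_injective_and_card]
    exact ⟨hinj, by rw [natCard_of_equiv φ, M1.natCard]⟩
  let E : B ≃* M1 p :=
    { Equiv.ofBijective e hbij with
      map_mul' := fun a b => unip_injective hp (by
        change unip hp (e (a * b)) = unip hp (e a * e b)
        rw [map_mul, he, he, he, map_mul]) }
  refine ⟨⟨φ', E.symm, fun u b => ?_⟩⟩
  obtain ⟨a, rfl⟩ := E.surjective u
  rw [MulEquiv.symm_apply_apply, ← lamM1_apply, ← he]
  rfl

end SkewBrace

/-! ### Invariance of the parameters under isomorphism. -/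

namespace M1

variable {p : ℕ} [Fact p.Prime]

theorem pow_r_of_mem_center {x : M1 p} (hx : x ∈ Subgroup.center (M1 p)) (n : ℕ) :
    (x ^ n).r = n * x.r := by
  obtain ⟨h1, h2⟩ := mem_center_iff.1 hx
  induction n with
  | zero => simp
  | succ n ih => rw [pow_succ, mul_r, ih, h1]; push_cast; ring

/-- Compatibility with the two actions forces `θ` to be triangular modulo the centre; `a` and `d`
are its diagonal entries. Comparing `π` at `σ` and at `τ` then gives the two relations. -/
theorem parameters_of_intertwine (hp : 3 < p) {s t s' t' : ZMod p} (θ : MulAut (M1 p))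
    (ω : M1 p → M1 p) (h : ∀ u x, θ (unip hp u x) = unip hp (ω u) (θ x))
    (hc : ∀ u, θ (cocycle s t u) = cocycle s' t' (ω u)) :
    ∃ a d : ZMod p, a ≠ 0 ∧ d ≠ 0 ∧ s' = a ^ 2 * s ∧ t' * a = d * t := by
  have h2 := two_ne_zero' hp
  have hdet := det_ne_zero θ
  have hk := apply_rho_r θ
  have hρ := apply_rho_s θ
  have e0 := h rho sigma
  have e1 := h sigma sigma
  have e2 := h tau sigma
  have c1 := hc rho
  have c2 := hc sigma
  have c3s := apply_s θ (cocycle s t tau)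
  have c3t := apply_t θ (cocycle s t tau)
  have i0 : unip hp rho sigma = rho * sigma := by ext <;> simp [unip_apply, rho, sigma]
  have i1 : unip hp sigma sigma = sigma * tau := by ext <;> simp [unip_apply, sigma, tau]
  have i2 : unip hp tau sigma = sigma := by ext <;> simp [unip_apply, sigma, tau]
  have i3 : cocycle s t rho * tau * tau = 1 := by
    ext <;> simp [cocycle, rho, tau]; ring
  have i4 : cocycle s t sigma = rho ^ s.val * tau := by
    rw [rho_pow]; ext <;> simp [cocycle, sigma, tau]
  replace i3 := congrArg θ i3
  rw [map_mul, map_mul, c1, map_one] at i3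
  rw [i4, map_mul, map_pow] at c2
  rw [i0, map_mul] at e0
  rw [i1, map_mul] at e1
  rw [i2] at e2
  rw [hc] at c3s c3t
  have hpow := pow_r_of_mem_center (mem_center_iff.2 hρ) s.val
  rw [hk, ZMod.natCast_val, ZMod.cast_id] at hpow
  generalize θ sigma = X at *
  generalize θ tau = Y at *
  generalize ω rho = u at *
  generalize ω sigma = v at *
  generalize ω tau = w at *
  -- `θ (σ τ)` is the image of `θ σ` under some `unip v`, which preserves the `s` coordinate.
  have hb : Y.s = 0 := by
    have := congrArg M1.s e1
    simpa [unip_apply] using this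
  rw [hb, mul_zero, sub_zero] at hdet
  have hd : Y.t ≠ 0 := left_ne_zero_of_mul hdet
  have ha : X.s ≠ 0 := right_ne_zero_of_mul hdet
  have hg1 : u.s = 0 := by
    have := congrArg M1.t e0
    simpa [unip_apply, hρ, ha] using this
  have hg2 : Y.t = v.s * X.s := by
    have := congrArg M1.t e1
    simpa [unip_apply] using this
  have hg2' : v.s ≠ 0 := by rintro h0; simp [h0] at hg2; exact hd hg2
  have hg3 : w.s = 0 := by
    have := congrArg M1.t e2
    simpa [unip_apply, ha] using this
  have hf3 : w.r * X.s + w.t * X.t = 0 := by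
    have := congrArg M1.r e2
    simp only [unip_apply, hg3] at this
    linear_combination -this
  have hh1 : u.t = 0 := by
    have := congrArg M1.s i3
    simpa [cocycle, hb, h2] using this
  have hc1 : Y.r = 0 := by
    have := congrArg M1.r i3
    simp [cocycle, hb, hg1, hh1] at this
    exact (mul_eq_zero.1 (show 2 * Y.r = 0 by linear_combination this)).resolve_left h2
  have hh2 : v.t = 0 := by
    have := congrArg M1.s c2
    simpa [cocycle, hb, hρ, h2] using this
  have hh3 : w.t = X.s := by
    simp only [cocycle, tau, hb] at c3s
    exact mul_left_cancel₀ h2 (by linear_combination c3s)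
  refine ⟨X.s, Y.t, ha, hd, ?_, ?_⟩
  · have := congrArg M1.r c2
    simp [cocycle, hpow, hb, hc1, hh2] at this
    rw [hg2] at this
    exact mul_right_cancel₀ hg2' (by linear_combination -this)
  · rw [hh3] at hf3
    have hf : w.r = -X.t := mul_right_cancel₀ ha (by linear_combination hf3)
    simp only [cocycle, tau, hg3, hh3, hf] at c3t
    linear_combination c3t

/-- Read through `psi`, the isomorphism is an automorphism `θ` of `M₁`; read on multiplicative
groups it is `ω`. Preservation of `λ` is the intertwining relation between them. -/
theorem parameters_of_ringEquiv (hp : 3 < p) {s t s' t' : ZMod p}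
    {h : Hol.IsRegular (kerOneSubgroup hp s t)} {h' : Hol.IsRegular (kerOneSubgroup hp s' t')}
    (f : Hol.Brace _ h ≃+* Hol.Brace _ h') :
    ∃ a d : ZMod p, a ≠ 0 ∧ d ≠ 0 ∧ s' = a ^ 2 * s ∧ t' * a = d * t := by
  let θ : MulAut (M1 p) := Hol.Brace.psiMulEquiv.symm.trans
    (f.toAddEquiv.toMultiplicative.trans Hol.Brace.psiMulEquiv)
  have hθ : ∀ k : Hol.Brace _ h, θ (Hol.Brace.psi k) = Hol.Brace.psi (f k) := by
    intro k
    change Hol.Brace.psi (f (Hol.Brace.psi.symm (Hol.Brace.psi k))) = _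
    rw [Equiv.symm_apply_apply]
  let ω : M1 p → M1 p := fun u => (kerOneEquiv hp s' t' h').symm (f (kerOneEquiv hp s t h u))
  have hω : ∀ u, kerOneEquiv hp s' t' h' (ω u) = f (kerOneEquiv hp s t h u) :=
    fun u => MulEquiv.apply_symm_apply _ _
  refine parameters_of_intertwine hp θ ω (fun u x => ?_) fun u => ?_
  · obtain ⟨k, rfl⟩ := (Hol.Brace.psi (hH := h)).surjective x
    have e1 := Hol.Brace.psi_lam (kerOneEquiv hp s t h u) k
    have e2 := Hol.Brace.psi_lam (kerOneEquiv hp s' t' h' (ω u)) (f k)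
    rw [val_kerOneEquiv] at e1 e2
    change _ = unip hp u _ at e1
    change _ = unip hp (ω u) _ at e2
    rw [← e1, hθ, hθ, ← e2, hω, map_add, map_neg, map_mul]
  · rw [← psi_kerOneEquiv hp s t h, hθ, ← hω, psi_kerOneEquiv]

theorem parameters_unique {δ : ZMod p} (hδ : ¬ IsSquare δ) {s t s' t' : ZMod p}
    (hs : s = 1 ∨ s = δ) (ht : t = 0 ∨ t = 1) (hs' : s' = 1 ∨ s' = δ) (ht' : t' = 0 ∨ t' = 1)
    (h : ∃ a d : ZMod p, a ≠ 0 ∧ d ≠ 0 ∧ s' = a ^ 2 * s ∧ t' * a = d * t) :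
    s' = s ∧ t' = t := by
  obtain ⟨a, d, ha, hd, h1, h2⟩ := h
  constructor
  · rcases hs with rfl | rfl <;> rcases hs' with rfl | rfl
    · rfl
    · exact absurd ⟨a, by rw [h1]; ring⟩ hδ
    · exact absurd ⟨a⁻¹, by field_simp; rw [h1]; ring⟩ hδ
    · rfl
  · rcases ht with rfl | rfl <;> rcases ht' with rfl | rfl
    · rfl
    · simp [ha] at h2
    · simp [hd.symm] at h2
    · rfl

end M1

/-! ### Assembly of the classification. -/

theorem mainTheorem7 (p : ℕ) [Fact p.Prime] (hp : 3 < p) :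
    -- socle and annihilator of an arbitrary skew brace `B` of `M₁` type
    (∀ (B : Type*) [SkewBrace B] (φ : Multiplicative B ≃* M1 p),
      (¬ SkewBrace.IsTrivial B →
        Nat.card (SkewBrace.lam B).ker = p ^ 2 ∨
        Nat.card (SkewBrace.lam B).ker = p ∨
        Nat.card (SkewBrace.lam B).ker = 1) ∧
      (Nat.card (SkewBrace.lam B).ker = p ^ 2 ∨ Nat.card (SkewBrace.lam B).ker = p →
        SkewBrace.socle B = {b | φ (Multiplicative.ofAdd b) ∈ Subgroup.zpowers M1.rho} ∧
        SkewBrace.annihilator B = {b | φ (Multiplicative.ofAdd b) ∈ Subgroup.zpowers M1.rho} ∧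
        SkewBrace.socle B = (AddSubgroup.center B : Set B) ∧
        Subgroup.zpowers (M1.rho : M1 p) = Subgroup.center (M1 p)) ∧
      (Nat.card (SkewBrace.lam B).ker = 1 →
        SkewBrace.socle B = {0} ∧ SkewBrace.annihilator B = {0} ∧
        -- `B` is not an annihilator extension with non-zero kernel
        ∀ (A Q : Type*) [SkewBrace A] [SkewBrace Q] (i : A → B) (q : B → Q),
          SkewBrace.IsAnnihilatorExtension i q → Subsingleton A)) ∧
    -- the skew braces of `M₁` type with `|ker λ| = 1` are exactly four up to isomorphism
    (∀ δ : ZMod p, ¬ IsSquare δ →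
      (∀ s t : ZMod p, s = 1 ∨ s = δ → t = 0 ∨ t = 1 →
        ∃ h : Hol.IsRegular (M1.kerOneSubgroup hp s t),
          SkewBrace.IsOfType (Hol.Brace _ h) (M1 p) ∧
          Nonempty (Hol.Brace _ h ≃* M1 p) ∧
          Nat.card (SkewBrace.lam (Hol.Brace _ h)).ker = 1) ∧
      (∀ (B : Type*) [SkewBrace B], SkewBrace.IsOfType B (M1 p) →
        Nat.card (SkewBrace.lam B).ker = 1 →
        ∃! st : ZMod p × ZMod p, (st.1 = 1 ∨ st.1 = δ) ∧ (st.2 = 0 ∨ st.2 = 1) ∧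
          ∃ h : Hol.IsRegular (M1.kerOneSubgroup hp st.1 st.2),
            Nonempty (B ≃+* Hol.Brace _ h))) := by
  have hp0 : p.Prime := Fact.out
  refine ⟨fun B _ φ => ⟨fun hB => ?_, fun hk => ?_, fun hk => ?_⟩, fun δ hδ => ⟨?_, ?_⟩⟩
  · obtain ⟨k, hk3, hk⟩ := SkewBrace.card_ker_lam_dvd φ
    have : k ≠ 3 := by
      rintro rfl
      exact hB (SkewBrace.isTrivial_of_card_ker φ hk)
    have h : k = 0 ∨ k = 1 ∨ k = 2 := by omega
    rcases h with rfl | rfl | rfl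
    · exact Or.inr (Or.inr (by simpa using hk))
    · exact Or.inr (Or.inl (by simpa using hk))
    · exact Or.inl hk
  · have hk1 : Nat.card (SkewBrace.lam B).ker ≠ 1 := by
      rcases hk with h | h <;> rw [h]
      · exact (Nat.one_lt_pow two_ne_zero hp0.one_lt).ne'
      · exact hp0.ne_one
    rw [← SkewBrace.center_eq_preimage φ]
    exact ⟨SkewBrace.socle_eq_center φ hk1, SkewBrace.annihilator_eq_center φ hk1,
      SkewBrace.socle_eq_center φ hk1, M1.zpowers_rho_eq_center⟩
  · exact ⟨SkewBrace.socle_eq_singleton hk, SkewBrace.annihilator_eq_singleton hk,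
      fun A Q _ _ i q h => h.subsingleton hk⟩
  · have hδ0 : δ ≠ 0 := by rintro rfl; exact hδ IsSquare.zero
    intro s t hs _
    have hs0 : s ≠ 0 := by rcases hs with rfl | rfl <;> simp [hδ0]
    have h := M1.isRegular_kerOneSubgroup hp hs0 t
    exact ⟨h, ⟨Hol.Brace.psiMulEquiv⟩, ⟨(M1.kerOneEquiv hp s t h).symm⟩,
      M1.card_ker_lam_kerOne hp s t h⟩
  · rintro B _ ⟨φ⟩ hk
    obtain ⟨F⟩ := SkewBrace.nonempty_unipotentFrame hp φ hk
    obtain ⟨F, s, t, hs, ht, hF⟩ := F.exists_normalized hδ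
    have h := M1.isRegular_kerOneSubgroup hp (F.s_ne_zero hF) t
    obtain ⟨f⟩ := F.nonempty_ringEquiv hF h
    refine ⟨(s, t), ⟨hs, ht, h, ⟨f⟩⟩, ?_⟩
    rintro ⟨s', t'⟩ ⟨hs', ht', h', ⟨f'⟩⟩
    obtain ⟨h1, h2⟩ := M1.parameters_unique hδ hs ht hs' ht'
      (M1.parameters_of_ringEquiv hp (f.symm.trans f'))
    exact Prod.ext h1 h2
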